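/- Let $n\ge 2$, let $p$ be a prime with $p\nmid n$, let $q=p^a$ with $a\ge 1$, and let $k$ be an algebraically closed field of characteristic $p$. Let $G=SL(n,k)$ with Lie algebra $\mathfrak g=sl(n,k)$, and let $F$ be the Frobenius map raising matrix entries to the $q$-th power, so that $G^F=SL(n,q)$ acts on $\mathfrak g^F=sl(n,q)$ by conjugation. Let $\Phi=\{\varepsilon_i-\varepsilon_j: i\ne j\}$ be the root system of type $A_{n-1}$ in the space $V=\operatorname{span}\Phi\subset\mathbb R^n$, with Weyl group $W$, simple roots $\Pi=\{\varepsilon_i-\varepsilon_{i+1}\}$, highest root $\theta$ and $\tilde\Pi=\Pi\cup\{-\theta\}$. Define $c_\alpha$ $(\alpha\in\tilde\Pi)$ by $\sum_{\alpha\in\tilde\Pi}c_\alpha\alpha=0$ and $c_{-\theta}=1$. Let $L$ be the lattice generated by the coroots $2\alpha/\langle\alpha,\alpha\rangle$, let $\hat L=\{v\in V:\langle v,\alpha\rangle\in\mathbb Z\ \text{for all}\ \alpha\in\Phi\}$, and let $f=[\hat L:L]$. For $S\subsetneq\tilde\Pi$ let $p(S,t)$ be the number of solutions in strictly positive integers $y_\alpha$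 of $\sum_{\alpha\in\tilde\Pi\setminus S}c_\alpha y_\alpha=t$, and write $S\sim J$ if $w(S)=J$ for some $w\in W$. For $J\subsetneq\tilde\Pi$, a semisimple element $x\in\mathfrak g^F$ has genus $(J,[\mathrm{id}])$ if its centralizer $C_G(x)$ is conjugate, by an element of $G^F$, to the subgroup of $G$ generated by the diagonal torus $T$ and the root groups $U_{\pm\alpha}$, $\alpha\in J$. It is split if it has genus $(J,[\mathrm{id}])$ for some $J\subsetneq\tilde\Pi$. A split semisimple element (or its orbit) has genus $\lambda=(i^{r_i})$, a partition of $n$ with $r_i$ parts equal to $i$, if for each $i\ge1$ its characteristic polynomial has exactly $r_i$ distinct linear factors occurring with multiplicity $i$. A set $J\subsetneq\tilde\Pi$ has type $\lambda$ if the orbits on $\{\varepsilon_1,\dots,\varepsilon_n\}$ of the group $W_J$ generated by the reflections in $J$ have as sizes the parts of $\lambda$ (so $W_J\cong\prod_i S_i^{r_i}$). Then: (1) For every $J\subsetneq\tilde\Pi$, the number of semisimple orbits of $G^F$ on $\mathfrak g^F$ of genus $(J,[\mathrm{id}])$ is finite and equal to $$\frac1f\sum_{S\sim J}p(S,q),$$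 the sum being over the proper subsets $S$ of $\tilde\Pi$ with $S\sim J$. (2) For every partition $\lambda=(i^{r_i})$ of $n$, the number of split semisimple orbits of $SL(n,q)$ on $sl(n,q)$ of genus $\lambda$ is finite and equal to $$\frac{(q-1)(q-2)\cdots\left(q+1-\sum_i r_i\right)}{r_1!\cdots r_n!}$$ (the numerator has $\sum_i r_i-1$ factors and is $1$ if $\sum_i r_i=1$). (3) If $J\subsetneq\tilde\Pi$ has type $\lambda$, then the orbits of genus $(J,[\mathrm{id}])$ are exactly the split semisimple orbits of genus $\lambda$, and $$\frac1f\sum_{S\sim J}p(S,q)=\frac{(q-1)(q-2)\cdots\left(q+1-\sum_i r_i\right)}{r_1!\cdots r_n!}.$$ -/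

import Mathlib

noncomputable section

namespace SplitGenus

open scoped RealInnerProductSpace

section RootSystems

variable {E : Type*} [NormedAddCommGroup E] [InnerProductSpace ℝ E]

/-- The coroot `2α / ⟨α, α⟩` of a vector `α`. -/
def coroot (α : E) : E := (2 / ⟪α, α⟫) • α

/-- The lattice `L` generated by the coroots of `Φ`. -/
def corootLattice (Φ : Set E) : AddSubgroup E := AddSubgroup.closure (coroot '' Φ)

/-- The lattice `L̂` of all `v` in the span `V` of `Φ` with `⟨v, α⟩ ∈ ℤ` for all `α ∈ Φ`. -/
def coweightLattice (Φ : Set E) : AddSubgroup E where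
  carrier := {v | v ∈ Submodule.span ℝ Φ ∧ ∀ α ∈ Φ, ∃ m : ℤ, ⟪v, α⟫ = (m : ℝ)}
  zero_mem' := ⟨zero_mem _, fun α _ => ⟨0, by simp⟩⟩
  add_mem' := by
    rintro v w ⟨hv, hv'⟩ ⟨hw, hw'⟩
    refine ⟨add_mem hv hw, fun α hα => ?_⟩
    obtain ⟨a, ha⟩ := hv' α hα
    obtain ⟨b, hb⟩ := hw' α hα
    exact ⟨a + b, by rw [inner_add_left, ha, hb]; push_cast; rfl⟩
  neg_mem' := by
    rintro v ⟨hv, hv'⟩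
    refine ⟨neg_mem hv, fun α hα => ?_⟩
    obtain ⟨a, ha⟩ := hv' α hα
    exact ⟨-a, by rw [inner_neg_left, ha]; push_cast; rfl⟩

/-- The index `f = [L̂ : L]`. -/
def connectionIndex (Φ : Set E) : ℕ := (corootLattice Φ).relIndex (coweightLattice Φ)

/-- The group generated by the orthogonal reflections in the hyperplanes `α^⊥`, `α ∈ R`.
For `R = Φ` it is the Weyl group `W`; for a set `R` of roots it is `W_R`. -/
def reflectionGroup (R : Set E) : Subgroup (E ≃ₗᵢ[ℝ] E) :=
  Subgroup.closure ((fun α : E => (Submodule.span ℝ {α})ᗮ.reflection) '' R)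

end RootSystems

section TypeA

variable (n : ℕ)

/-- The standard basis vector `ε_i` of `ℝⁿ`. -/
def stdVec {n : ℕ} (i : Fin n) : EuclideanSpace ℝ (Fin n) := EuclideanSpace.single i 1

/-- The root system of type `A_{n-1}`: all `ε_i - ε_j` with `i ≠ j`. -/
def roots : Set (EuclideanSpace ℝ (Fin n)) := {α | ∃ i j, i ≠ j ∧ α = stdVec i - stdVec j}

/-- The Weyl group `W` of type `A_{n-1}`. -/
def weylGroup : Subgroup (EuclideanSpace ℝ (Fin n) ≃ₗᵢ[ℝ] EuclideanSpace ℝ (Fin n)) :=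
  reflectionGroup (roots n)

variable [NeZero n]

/-- The highest root `θ = ε_0 - ε_{n-1}` (here `-1` is the last index, as `Fin n` is cyclic). -/
def highestRoot : EuclideanSpace ℝ (Fin n) := stdVec 0 - stdVec (-1)

/-- The set `Π̃`, indexed by `Fin n`: the simple root `ε_i - ε_{i+1}` for `i` not the last index,
and `-θ` for the last index `-1`. -/
def extSimpleRoot (i : Fin n) : EuclideanSpace ℝ (Fin n) :=
  if i = -1 then -highestRoot n else stdVec i - stdVec (i + 1)

/-- The defining equations of the coefficients: `∑ c_α α = 0` over `Π̃`, and `c_{-θ} = 1`. -/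
def IsMarks (c : Fin n → ℕ) : Prop :=
  (∑ i, c i • extSimpleRoot n i = 0) ∧ c (-1) = 1

theorem extSimpleRoot_eq (i : Fin n) :
    extSimpleRoot n i = stdVec i - stdVec (i + 1) := by
  unfold extSimpleRoot highestRoot
  split_ifs with h
  · subst h; simp
  · rfl

theorem exists_isMarks : ∃ c, IsMarks n c := by
  refine ⟨fun _ => 1, ?_, rfl⟩
  simp only [one_smul, extSimpleRoot_eq, Finset.sum_sub_distrib, sub_eq_zero]
  exact (Equiv.sum_comp (Equiv.addRight (1 : Fin n)) stdVec).symm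

/-- The coefficients `c_α`, `α ∈ Π̃`. -/
def mark : Fin n → ℕ := Classical.choose (exists_isMarks n)

variable {n}

/-- The subset of `Π̃` given by a set of indices. -/
def rootSet (S : Finset (Fin n)) : Set (EuclideanSpace ℝ (Fin n)) :=
  extSimpleRoot n '' (S : Set (Fin n))

/-- `S₁ ∼ S₂`: some `w ∈ W` satisfies `w(S₁) = S₂`. -/
def WEquiv (S₁ S₂ : Finset (Fin n)) : Prop :=
  ∃ w ∈ weylGroup n, (fun v => w v) '' rootSet S₁ = rootSet S₂

/-- `p(S, t)`: the number of solutions in strictly positive integers `y_α`, `α ∈ Π̃ - S`, of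
`∑ c_α y_α = t`. -/
def numSolutions (S : Finset (Fin n)) (t : ℕ) : ℕ :=
  Nat.card {y : {i : Fin n // i ∉ S} → ℕ+ // ∑ i, mark n i.1 * (y i : ℕ) = t}

open Classical in
/-- `(1/f) ∑_{S ∼ J} p(S, t)`, the sum being over the proper subsets `S` of `Π̃` with `S ∼ J`. -/
def sommersSum (J : Finset (Fin n)) (t : ℕ) : ℚ :=
  (1 / (connectionIndex (roots n) : ℚ)) *
    ∑ S ∈ Finset.univ.filter (fun S : Finset (Fin n) => S ≠ Finset.univ ∧ WEquiv S J),
      (numSolutions S t : ℚ)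

open Classical in
/-- The set of indices `j` such that `ε_j` lies in the `W_J`-orbit of `ε_i`. -/
def block (J : Finset (Fin n)) (i : Fin n) : Finset (Fin n) :=
  Finset.univ.filter fun j => ∃ w ∈ reflectionGroup (rootSet J), w (stdVec i) = stdVec j

open Classical in
/-- `J` is of type `lam`: the sizes of the orbits of `W_J` on the `n` coordinates are the parts
of `lam`, so that `W_J` is the product of the symmetric groups on these orbits. -/
def HasType (J : Finset (Fin n)) (lam : n.Partition) : Prop :=
  (Finset.univ.image (block J)).val.map Finset.card = lam.parts

end TypeA

section Group

variable (n p a : ℕ) (k : Type*) [Field k] [Fact p.Prime] [CharP k p]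

/-- `G^F`: the fixed points in `G = SL(n, k)` of the Frobenius map `F` that raises all matrix
entries to the power `q = p ^ a`. This is `SL(n, q)`. -/
def groupFixed : Subgroup (Matrix.SpecialLinearGroup (Fin n) k) :=
  (Matrix.SpecialLinearGroup.map (n := Fin n) (iterateFrobenius k p a)).eqLocus (MonoidHom.id _)

/-- `g^F`: the fixed points of `F` in the Lie algebra of trace zero matrices over `k`.
This is `sl(n, q)`. -/
def lieFixed : Set (Matrix (Fin n) (Fin n) k) :=
  {x | x ∈ LieAlgebra.SpecialLinear.sl (Fin n) k ∧ x.map (iterateFrobenius k p a) = x}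

variable {n k}

/-- The adjoint action `g x g⁻¹`. -/
def adj (g : Matrix.SpecialLinearGroup (Fin n) k) (x : Matrix (Fin n) (Fin n) k) :
    Matrix (Fin n) (Fin n) k :=
  (g : Matrix (Fin n) (Fin n) k) * x * ((g⁻¹ : Matrix.SpecialLinearGroup (Fin n) k) : Matrix _ _ k)

/-- The orbit of `x` under `G^F`. -/
def orbit (x : Matrix (Fin n) (Fin n) k) : Set (Matrix (Fin n) (Fin n) k) :=
  {y | ∃ g ∈ groupFixed n p a k, y = adj g x}

theorem adj_mul (g h : Matrix.SpecialLinearGroup (Fin n) k) (x : Matrix (Fin n) (Fin n) k) :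
    adj (g * h) x = adj g (adj h x) := by
  simp only [adj, mul_inv_rev, Matrix.SpecialLinearGroup.coe_mul, mul_assoc]

theorem adj_one (x : Matrix (Fin n) (Fin n) k) : adj 1 x = x := by
  simp only [adj, inv_one, Matrix.SpecialLinearGroup.coe_one, one_mul, mul_one]

/-- The centralizer `C_G(x)` in `G = SL(n, k)`. -/
def centralizer (x : Matrix (Fin n) (Fin n) k) : Subgroup (Matrix.SpecialLinearGroup (Fin n) k) where
  carrier := {g | adj g x = x}
  one_mem' := adj_one x
  mul_mem' {g h} hg hh := (adj_mul g h x).trans ((congrArg (adj g) hh).trans hg)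
  inv_mem' {g} hg := by
    have h := adj_mul g⁻¹ g x
    rw [inv_mul_cancel, adj_one, show adj g x = x from hg] at h
    exact h.symm

variable (n k) in
/-- The split maximal torus `T` of diagonal matrices in `SL(n, k)`. -/
def torus : Set (Matrix.SpecialLinearGroup (Fin n) k) :=
  {g | (g : Matrix (Fin n) (Fin n) k).IsDiag}

variable (k) in
/-- The root group `U_α`: for `α = ε_i - ε_j` the matrices `1 + c E_{ij}`. -/
def rootGroup (α : EuclideanSpace ℝ (Fin n)) : Set (Matrix.SpecialLinearGroup (Fin n) k) :=
  {g | ∃ i j, i ≠ j ∧ α = stdVec i - stdVec j ∧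
    ∃ c : k, (g : Matrix (Fin n) (Fin n) k) = Matrix.transvection i j c}

variable (k) in
/-- The subgroup of `SL(n, k)` generated by `T` and the root groups `U_α`, `U_{-α}` for
`α ∈ J`. -/
def leviGroup [NeZero n] (J : Finset (Fin n)) : Subgroup (Matrix.SpecialLinearGroup (Fin n) k) :=
  Subgroup.closure (torus n k ∪ ⋃ α ∈ rootSet J, (rootGroup k α ∪ rootGroup k (-α)))

/-- `x` is a semisimple element of `g^F`. -/
def IsSemisimpleElt (x : Matrix (Fin n) (Fin n) k) : Prop :=
  x ∈ lieFixed n p a k ∧ Module.End.IsSemisimple (Matrix.toLin' x)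

/-- The semisimple element `x` of `g^F` lies in the genus `(J, [id])`: its centralizer in `G` is
conjugate under `G^F` to the group generated by `T` and the `U_{±α}`, `α ∈ J`. -/
def InGenus [NeZero n] (J : Finset (Fin n)) (x : Matrix (Fin n) (Fin n) k) : Prop :=
  IsSemisimpleElt p a x ∧ ∃ g ∈ groupFixed n p a k,
    centralizer x = (leviGroup k J).map (MulAut.conj g).toMonoidHom

variable (k) in
/-- The set of semisimple orbits of `G^F` on `g^F` of genus `(J, [id])`. -/
def genusOrbits [NeZero n] (J : Finset (Fin n)) : Set (Set (Matrix (Fin n) (Fin n) k)) :=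
  {O | ∃ x, InGenus p a J x ∧ O = orbit p a x}

/-- `x` is split semisimple: of genus `(J, [id])` for some proper subset `J` of `Π̃`. -/
def IsSplit [NeZero n] (x : Matrix (Fin n) (Fin n) k) : Prop :=
  ∃ J : Finset (Fin n), J ≠ Finset.univ ∧ InGenus p a J x

variable (k) in
/-- The set of split semisimple orbits of `G^F` on `g^F` of genus `lam = (i^{r_i})`: for each
`i ≥ 1` the characteristic polynomial has exactly `r_i` linear factors of multiplicity `i`. -/
def splitOrbits [NeZero n] (lam : n.Partition) : Set (Set (Matrix (Fin n) (Fin n) k)) :=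
  {O | ∃ x : Matrix (Fin n) (Fin n) k, IsSplit p a x ∧
    (∀ i, 1 ≤ i → {b : k | x.charpoly.rootMultiplicity b = i}.ncard = lam.parts.count i) ∧
    O = orbit p a x}

end Group

/-- `(q-1)(q-2)⋯(q+1-∑ r_i) / (r_1! ⋯ r_n!)` for `lam = (i^{r_i})`. -/
def genusCount {n : ℕ} (lam : n.Partition) (q : ℕ) : ℚ :=
  (∏ j ∈ Finset.Icc 1 (lam.parts.card - 1), ((q : ℚ) - (j : ℚ))) /
    ∏ i ∈ Finset.Icc 1 n, ((lam.parts.count i).factorial : ℚ)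

end SplitGenus

end

/-!
Everything is reduced to two finite counts, one of diagonal matrices and one of subsets of the
extended Dynkin diagram, both expressed through the multiset of block sizes of `J`.

*Combinatorics of `Π̃`.* The extended diagram is the cycle `i — i + 1` on `Fin n`, and the Weyl
group is the group of coordinate permutations (`mem_weylGroup_iff`). The orbits of `W_J` on
coordinates are the connected components of the edges in `J` (`mem_block_iff`). A proper subset can be rotated
so as to miss the last node, and then it is the same thing as a composition of `n`
(`compSet`, `exists_isLinkIso_to_compSet`); hence `S ∼ J` holds exactly when `S` and `J` have the
same block sizes (`exists_isLinkIso_of_blockSizes_eq`, `IsLinkIso.blockSizes_eq`). Counting the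
pairs `(S, c)` with `c ∉ S ∼ J` by rotating `c` to the last node shows that, for `s` blocks of which
`r_i` have size `i`, there are `n (s - 1)! / ∏ r_i!` such `S`. All marks are `1`, so
`p(S, q) = (q - 1).choose (s - 1)`, and the connection index is `n`; this evaluates the sum
(`sommersSum_eq_genusCount`).

*Matrices.* The centralizer of a diagonal matrix whose entries separate exactly the blocks of `J` is
the Levi subgroup of `J` (`centralizer_diagonal_eq`): block by block, an invertible matrix is a
product of transvections and diagonal matrices, and the transvections within a block are iterated
commutators of those along its edges. Conversely, a matrix with this centralizer commutes with the
torus and is therefore such a diagonal matrix. So the elements of genus `(J, [id])` are the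
`SL(n, q)`-conjugates of trace zero diagonal matrices over `𝔽_q` that separate exactly the blocks
of `J` (`inGenus_iff`). Two diagonal matrices lie in the same orbit precisely when their entries
agree up to order, since monomial matrices with entries `0, ±1` realize all permutations
(`orbit_diagonal_eq_iff`). It follows that the genus depends only on the block sizes
(`genusOrbits_eq_splitOrbits`).

*Counting orbits.* An orbit of genus `(J, [id])` is an injection of the set of blocks into `𝔽_q`
with weighted sum zero, modulo the `∏ r_i!` permutations of blocks of equal size. As `n` is invertible
in `𝔽_q`, translation by constants shows that a proportion `1/q` of all injections has weighted sum
zero (`card_injective_sum_eq_zero`), which gives `(q - 1)⋯(q + 1 - s) / ∏ r_i!`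
(`genusOrbits_finite_and_ncard`).
-/

noncomputable section

namespace SplitGenus

open scoped RealInnerProductSpace

/-! ### The Weyl group as the group of coordinate permutations -/

/-- The isometry of `ℝⁿ` that permutes the standard basis: `ε_i ↦ ε_{σ i}`. -/
def permIso {n : ℕ} (σ : Equiv.Perm (Fin n)) :
    EuclideanSpace ℝ (Fin n) ≃ₗᵢ[ℝ] EuclideanSpace ℝ (Fin n) :=
  LinearIsometryEquiv.piLpCongrLeft 2 ℝ ℝ σ

theorem permIso_stdVec {n : ℕ} (σ : Equiv.Perm (Fin n)) (i : Fin n) :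
    permIso σ (stdVec i) = stdVec (σ i) :=
  EuclideanSpace.piLpCongrLeft_single σ i 1

theorem isometry_ext_stdVec {n : ℕ}
    {f g : EuclideanSpace ℝ (Fin n) ≃ₗᵢ[ℝ] EuclideanSpace ℝ (Fin n)}
    (h : ∀ i, f (stdVec i) = g (stdVec i)) : f = g := by
  apply LinearIsometryEquiv.toLinearEquiv_injective
  apply (EuclideanSpace.basisFun (Fin n) ℝ).toBasis.ext'
  intro i
  simpa [stdVec] using h i

theorem isometry_mul_apply {n : ℕ}
    (f g : EuclideanSpace ℝ (Fin n) ≃ₗᵢ[ℝ] EuclideanSpace ℝ (Fin n))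
    (v : EuclideanSpace ℝ (Fin n)) : (f * g) v = f (g v) := rfl

theorem permIso_mul {n : ℕ} (σ τ : Equiv.Perm (Fin n)) :
    permIso (σ * τ) = permIso σ * permIso τ :=
  isometry_ext_stdVec fun i => by
    rw [isometry_mul_apply, permIso_stdVec, permIso_stdVec, permIso_stdVec]; rfl

theorem permIso_one {n : ℕ} : permIso (1 : Equiv.Perm (Fin n)) = 1 :=
  isometry_ext_stdVec fun i => by rw [permIso_stdVec]; rfl

theorem permIso_inv {n : ℕ} (σ : Equiv.Perm (Fin n)) : permIso σ⁻¹ = (permIso σ)⁻¹ :=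
  eq_inv_of_mul_eq_one_left (by rw [← permIso_mul, inv_mul_cancel, permIso_one])

theorem inner_stdVec {n : ℕ} (i j : Fin n) :
    ⟪stdVec i, stdVec j⟫ = if i = j then (1 : ℝ) else 0 := by
  simp [stdVec, EuclideanSpace.inner_single_left]

theorem norm_stdVec {n : ℕ} (i : Fin n) : ‖(stdVec i : EuclideanSpace ℝ (Fin n))‖ = 1 := by
  simp [stdVec]

theorem stdVec_injective {n : ℕ} : Function.Injective (stdVec : Fin n → _) := fun i j h => by
  by_contra hij
  have := inner_stdVec i j
  rw [h, inner_stdVec, if_pos rfl, if_neg hij] at this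
  exact one_ne_zero this

/-- The reflection in `(ε_i - ε_j)^⊥` exchanges the coordinates `i` and `j`. -/
theorem reflection_stdVec_sub {n : ℕ} (i j : Fin n) :
    (Submodule.span ℝ {(stdVec i - stdVec j : EuclideanSpace ℝ (Fin n))})ᗮ.reflection =
      permIso (Equiv.swap i j) := by
  refine isometry_ext_stdVec fun l => ?_
  rw [permIso_stdVec]
  by_cases hi : l = i
  · subst hi
    rw [Equiv.swap_apply_left]
    exact Submodule.reflection_sub (by rw [norm_stdVec, norm_stdVec])
  by_cases hj : l = j
  · subst hj
    have h : (Submodule.span ℝ {(stdVec i - stdVec l : EuclideanSpace ℝ (Fin n))})ᗮ.reflection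
        (stdVec i) = stdVec l := Submodule.reflection_sub (by rw [norm_stdVec, norm_stdVec])
    rw [Equiv.swap_apply_right]
    have h' := congrArg
      (Submodule.span ℝ {(stdVec i - stdVec l : EuclideanSpace ℝ (Fin n))})ᗮ.reflection h
    rw [Submodule.reflection_reflection] at h'
    exact h'.symm
  rw [Equiv.swap_apply_of_ne_of_ne hi hj]
  apply Submodule.reflection_mem_subspace_eq_self
  rw [Submodule.mem_orthogonal_singleton_iff_inner_left, inner_sub_right, inner_stdVec,
    inner_stdVec, if_neg hi, if_neg hj, sub_zero]

theorem stdVec_sub_inj {n : ℕ} {i j k l : Fin n} (hij : i ≠ j)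
    (h : (stdVec i - stdVec j : EuclideanSpace ℝ (Fin n)) = stdVec k - stdVec l) :
    i = k ∧ j = l := by
  have h1 := congrArg (fun v => ⟪v, stdVec i⟫) h
  have h2 := congrArg (fun v => ⟪v, stdVec j⟫) h
  simp only [inner_sub_left, inner_stdVec] at h1 h2
  constructor
  · by_contra hik
    rw [if_neg (Ne.symm hij), if_neg (Ne.symm hik)] at h1
    split_ifs at h1 <;> norm_num at h1
  · by_contra hjl
    rw [if_neg hij, if_neg (Ne.symm hjl)] at h2
    split_ifs at h2 <;> norm_num at h2

theorem mem_weylGroup_iff {n : ℕ}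
    {w : EuclideanSpace ℝ (Fin n) ≃ₗᵢ[ℝ] EuclideanSpace ℝ (Fin n)} :
    w ∈ weylGroup n ↔ ∃ σ, w = permIso σ := by
  constructor
  · intro hw
    unfold weylGroup reflectionGroup at hw
    induction hw using Subgroup.closure_induction with
    | mem x hx =>
      obtain ⟨_, ⟨i, j, _, rfl⟩, rfl⟩ := hx
      exact ⟨_, reflection_stdVec_sub i j⟩
    | one => exact ⟨1, permIso_one.symm⟩
    | mul x y _ _ hx hy =>
      obtain ⟨σ, rfl⟩ := hx
      obtain ⟨τ, rfl⟩ := hy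
      exact ⟨σ * τ, (permIso_mul σ τ).symm⟩
    | inv x _ hx =>
      obtain ⟨σ, rfl⟩ := hx
      exact ⟨σ⁻¹, (permIso_inv σ).symm⟩
  · rintro ⟨σ, rfl⟩
    have hσ : σ ∈ Subgroup.closure {σ : Equiv.Perm (Fin n) | σ.IsSwap} := by
      rw [Equiv.Perm.closure_isSwap]; trivial
    induction hσ using Subgroup.closure_induction with
    | mem x hx =>
      obtain ⟨i, j, hij, rfl⟩ := hx
      rw [← reflection_stdVec_sub]
      exact Subgroup.subset_closure ⟨_, ⟨i, j, hij, rfl⟩, rfl⟩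
    | one => rw [permIso_one]; exact one_mem _
    | mul x y _ _ hx hy => rw [permIso_mul]; exact mul_mem hx hy
    | inv x _ hx => rw [permIso_inv]; exact inv_mem hx

/-! ### The blocks of a subset of the extended Dynkin diagram -/

section Blocks

variable {n : ℕ} [NeZero n]

theorem ne_add_one (hn : 2 ≤ n) (i : Fin n) : i ≠ i + 1 := by
  obtain ⟨m, rfl⟩ : ∃ m, n = m + 2 := ⟨n - 2, by omega⟩
  simp

/-- `i` and `j` lie in the same connected component of the graph on `Fin n` with the edges
`i — i + 1` for `i ∈ J`. -/
def Linked (J : Finset (Fin n)) : Fin n → Fin n → Prop :=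
  Relation.EqvGen fun a b => a ∈ J ∧ b = a + 1

theorem linked_equivalence (J : Finset (Fin n)) : Equivalence (Linked J) :=
  Relation.EqvGen.is_equivalence _

theorem mem_block_iff (J : Finset (Fin n)) (i j : Fin n) : j ∈ block J i ↔ Linked J i j := by
  classical
  simp only [block, Finset.mem_filter, Finset.mem_univ, true_and]
  constructor
  · rintro ⟨w, hw, hij⟩
    -- every element of `W_J` permutes the basis vectors within the components
    suffices H : ∃ σ : Equiv.Perm (Fin n), w = permIso σ ∧ ∀ l, Linked J l (σ l) by
      obtain ⟨σ, rfl, hσ⟩ := H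
      rw [permIso_stdVec] at hij
      exact stdVec_injective hij ▸ hσ i
    clear hij
    unfold reflectionGroup at hw
    induction hw using Subgroup.closure_induction with
    | mem x hx =>
      obtain ⟨_, ⟨a, ha, rfl⟩, rfl⟩ := hx
      refine ⟨Equiv.swap a (a + 1), by simp only [extSimpleRoot_eq, reflection_stdVec_sub], ?_⟩
      intro l
      have h : Linked J a (a + 1) := Relation.EqvGen.rel _ _ ⟨ha, rfl⟩
      by_cases h1 : l = a
      · rw [h1, Equiv.swap_apply_left]; exact h
      by_cases h2 : l = a + 1
      · rw [h2, Equiv.swap_apply_right]; exact h.symm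
      rw [Equiv.swap_apply_of_ne_of_ne h1 h2]
      exact Relation.EqvGen.refl _
    | one => exact ⟨1, permIso_one.symm, fun l => Relation.EqvGen.refl _⟩
    | mul x y _ _ hx hy =>
      obtain ⟨σ, rfl, hσ⟩ := hx
      obtain ⟨τ, rfl, hτ⟩ := hy
      exact ⟨σ * τ, (permIso_mul σ τ).symm, fun l => (hτ l).trans _ _ _ (hσ (τ l))⟩
    | inv x _ hx =>
      obtain ⟨σ, rfl, hσ⟩ := hx
      refine ⟨σ⁻¹, (permIso_inv σ).symm, fun l => ?_⟩
      have := hσ (σ⁻¹ l)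
      rw [← Equiv.Perm.mul_apply, mul_inv_cancel, Equiv.Perm.one_apply] at this
      exact this.symm
  · intro h
    induction h with
    | rel x y hxy =>
      obtain ⟨hx, rfl⟩ := hxy
      refine ⟨_, Subgroup.subset_closure ⟨_, ⟨x, hx, rfl⟩, rfl⟩, ?_⟩
      simp only [extSimpleRoot_eq, reflection_stdVec_sub, permIso_stdVec, Equiv.swap_apply_left]
    | refl x => exact ⟨1, one_mem _, rfl⟩
    | symm x y _ ih =>
      obtain ⟨w, hw, h⟩ := ih
      refine ⟨w⁻¹, inv_mem hw, ?_⟩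
      rw [← h]
      exact w.symm_apply_apply _
    | trans x y z _ _ ih1 ih2 =>
      obtain ⟨w, hw, h⟩ := ih1
      obtain ⟨w', hw', h'⟩ := ih2
      exact ⟨w' * w, mul_mem hw' hw, by rw [isometry_mul_apply, h, h']⟩

open Classical in
/-- The multiset of the sizes of the blocks of `J`. -/
def blockSizes (J : Finset (Fin n)) : Multiset ℕ :=
  (Finset.univ.image (block J)).val.map Finset.card

theorem hasType_iff (J : Finset (Fin n)) (lam : n.Partition) :
    HasType J lam ↔ blockSizes J = lam.parts := Iff.rfl

/-- The block sizes are the fibre sizes of any surjective labelling of the blocks. -/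
theorem blockSizes_eq_map {ι : Type*} [Fintype ι] [DecidableEq ι] {J : Finset (Fin n)}
    {b : Fin n → ι} (hb : Function.Surjective b) (h : ∀ i j, Linked J i j ↔ b i = b j) :
    blockSizes J = Finset.univ.val.map fun t => (Finset.univ.filter fun i => b i = t).card := by
  classical
  let B : ι → Finset (Fin n) := fun t => Finset.univ.filter fun i => b i = t
  have hB : ∀ i, block J i = B (b i) := fun i => by
    ext j
    simp only [mem_block_iff, h, B, Finset.mem_filter, Finset.mem_univ, true_and, eq_comm]
  have hinj : Function.Injective B := fun t u htu => by
    obtain ⟨i, rfl⟩ := hb t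
    have : i ∈ B u := htu ▸ by simp [B]
    simpa [B] using this
  have himg : Finset.univ.image (block J) = Finset.univ.map ⟨B, hinj⟩ := by
    ext s
    simp only [Finset.mem_image, Finset.mem_univ, true_and, Finset.mem_map,
      Function.Embedding.coeFn_mk, hB]
    exact ⟨fun ⟨i, hi⟩ => ⟨b i, hi⟩, fun ⟨t, ht⟩ => (hb t).imp fun i hi => by rw [hi, ht]⟩
  rw [blockSizes, himg, Finset.map_val, Multiset.map_map]
  rfl

/-- `σ` carries the edges `i — i + 1`, `i ∈ S`, onto the edges `j — j + 1`, `j ∈ J`. -/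
def IsLinkIso (σ : Equiv.Perm (Fin n)) (S J : Finset (Fin n)) : Prop :=
  (∀ i ∈ S, σ i ∈ J ∧ σ (i + 1) = σ i + 1) ∧ ∀ j ∈ J, σ⁻¹ j ∈ S ∧ σ⁻¹ (j + 1) = σ⁻¹ j + 1

theorem IsLinkIso.inv {σ : Equiv.Perm (Fin n)} {S J : Finset (Fin n)} (h : IsLinkIso σ S J) :
    IsLinkIso σ⁻¹ J S := ⟨h.2, by rw [inv_inv]; exact h.1⟩

theorem IsLinkIso.mul {σ τ : Equiv.Perm (Fin n)} {S J K : Finset (Fin n)}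
    (hτ : IsLinkIso τ J K) (hσ : IsLinkIso σ S J) : IsLinkIso (τ * σ) S K := by
  constructor
  · intro i hi
    obtain ⟨h1, h2⟩ := hσ.1 i hi
    obtain ⟨h3, h4⟩ := hτ.1 _ h1
    simp only [Equiv.Perm.mul_apply]
    exact ⟨h3, by rw [h2, h4]⟩
  · intro i hi
    obtain ⟨h1, h2⟩ := hτ.2 i hi
    obtain ⟨h3, h4⟩ := hσ.2 _ h1
    simp only [mul_inv_rev, Equiv.Perm.mul_apply]
    exact ⟨h3, by rw [h2, h4]⟩

theorem IsLinkIso.linked {σ : Equiv.Perm (Fin n)} {S J : Finset (Fin n)} (h : IsLinkIso σ S J)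
    (i j : Fin n) : Linked J (σ i) (σ j) ↔ Linked S i j := by
  have key : ∀ {τ : Equiv.Perm (Fin n)} {A B : Finset (Fin n)}, IsLinkIso τ A B →
      ∀ i j, Linked A i j → Linked B (τ i) (τ j) := by
    intro τ A B hτ i j hij
    induction hij with
    | rel x y hxy =>
      obtain ⟨hx, rfl⟩ := hxy
      exact Relation.EqvGen.rel _ _ (hτ.1 x hx)
    | refl x => exact Relation.EqvGen.refl _
    | symm x y _ ih => exact ih.symm
    | trans x y z _ _ ih1 ih2 => exact ih1.trans _ _ _ ih2
  refine ⟨fun h' => ?_, key h i j⟩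
  simpa using key h.inv _ _ h'

theorem IsLinkIso.card_eq {σ : Equiv.Perm (Fin n)} {S J : Finset (Fin n)}
    (h : IsLinkIso σ S J) : S.card = J.card :=
  le_antisymm (Finset.card_le_card_of_injOn σ (fun i hi => (h.1 i hi).1) σ.injective.injOn)
    (Finset.card_le_card_of_injOn _ (fun i hi => (h.2 i hi).1) (σ⁻¹).injective.injOn)

theorem IsLinkIso.ne_univ {σ : Equiv.Perm (Fin n)} {S J : Finset (Fin n)}
    (h : IsLinkIso σ S J) (hJ : J ≠ Finset.univ) : S ≠ Finset.univ := by
  rintro rfl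
  exact hJ ((Finset.card_eq_iff_eq_univ J).mp (by rw [← h.card_eq, Finset.card_univ]))

theorem IsLinkIso.blockSizes_eq {σ : Equiv.Perm (Fin n)} {S J : Finset (Fin n)}
    (h : IsLinkIso σ S J) : blockSizes S = blockSizes J := by
  classical
  let Q := Quotient (⟨Linked J, linked_equivalence J⟩ : Setoid (Fin n))
  let b : Fin n → Q := Quotient.mk _
  have hb : Function.Surjective b := Quotient.mk_surjective
  have hJ : ∀ i j, Linked J i j ↔ b i = b j := fun i j =>
    (Quotient.eq (r := ⟨Linked J, linked_equivalence J⟩)).symm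
  have hS : ∀ i j, Linked S i j ↔ (b ∘ σ) i = (b ∘ σ) j := fun i j => by
    rw [← h.linked, hJ]; rfl
  rw [blockSizes_eq_map hb hJ, blockSizes_eq_map (hb.comp σ.surjective) hS]
  refine Multiset.map_congr rfl fun t _ => ?_
  refine Finset.card_bij (fun i _ => σ i) (by simp) (by simp) fun j hj => ⟨σ⁻¹ j, ?_, by simp⟩
  simpa using hj

theorem wEquiv_iff (hn : 2 ≤ n) (S J : Finset (Fin n)) :
    WEquiv S J ↔ ∃ σ, IsLinkIso σ S J := by
  have key : ∀ σ : Equiv.Perm (Fin n), ∀ A B : Finset (Fin n),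
      (fun v => permIso σ v) '' rootSet A ⊆ rootSet B ↔ ∀ i ∈ A, σ i ∈ B ∧ σ (i + 1) = σ i + 1 := by
    intro σ A B
    simp only [rootSet, Set.image_subset_iff]
    constructor
    · intro h i hi
      obtain ⟨j, hj, hij⟩ := h hi
      simp only [extSimpleRoot_eq, map_sub, permIso_stdVec] at hij
      obtain ⟨h1, h2⟩ := stdVec_sub_inj (ne_add_one hn j) hij
      subst h1
      exact ⟨hj, h2.symm⟩
    · intro h i hi
      obtain ⟨h1, h2⟩ := h i hi
      exact ⟨σ i, h1, by simp only [extSimpleRoot_eq, map_sub, permIso_stdVec, h2]⟩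
  have inv_image : ∀ σ : Equiv.Perm (Fin n), ∀ A : Set (EuclideanSpace ℝ (Fin n)),
      ∀ B, B ⊆ (fun v => permIso σ v) '' A ↔ (fun v => permIso σ⁻¹ v) '' B ⊆ A := by
    intro σ A B
    have h1 : ∀ v, permIso σ⁻¹ (permIso σ v) = v := fun v => by
      rw [← isometry_mul_apply, ← permIso_mul, inv_mul_cancel, permIso_one]; rfl
    have h2 : ∀ v, permIso σ (permIso σ⁻¹ v) = v := fun v => by
      rw [← isometry_mul_apply, ← permIso_mul, mul_inv_cancel, permIso_one]; rfl
    constructor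
    · rintro h _ ⟨v, hv, rfl⟩
      obtain ⟨u, hu, rfl⟩ := h hv
      simpa only [h1] using hu
    · intro h v hv
      exact ⟨_, h ⟨v, hv, rfl⟩, h2 v⟩
  constructor
  · rintro ⟨w, hw, h⟩
    obtain ⟨σ, rfl⟩ := mem_weylGroup_iff.mp hw
    exact ⟨σ, (key σ S J).mp h.subset, (key σ⁻¹ J S).mp ((inv_image σ _ _).mp h.superset)⟩
  · rintro ⟨σ, h⟩
    exact ⟨permIso σ, mem_weylGroup_iff.mpr ⟨σ, rfl⟩,
      Set.Subset.antisymm ((key σ S J).mpr h.1) ((inv_image σ _ _).mpr ((key σ⁻¹ J S).mpr h.2))⟩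

/-- Rotating the extended Dynkin diagram is effected by an element of the Weyl group, a cyclic
permutation of the coordinates. -/
theorem isLinkIso_rotate (r : Fin n) (J : Finset (Fin n)) :
    IsLinkIso (Equiv.addRight r) J (J.map (Equiv.addRight r).toEmbedding) := by
  constructor
  · intro i hi
    refine ⟨Finset.mem_map_of_mem _ hi, ?_⟩
    simp only [Equiv.coe_addRight, add_right_comm]
  · intro j hj
    obtain ⟨i, hi, rfl⟩ := Finset.mem_map.mp hj
    have : (Equiv.addRight r)⁻¹ (i + r + 1) = i + 1 := by
      rw [Equiv.Perm.inv_eq_iff_eq, Equiv.coe_addRight, add_right_comm]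
    simpa using ⟨hi, this⟩

end Blocks

/-! ### Subsets of the extended Dynkin diagram and compositions of `n` -/

/-- Two families with the same multiset of values differ by a bijection of the index types. -/
theorem exists_equiv_of_map_eq {α β γ : Type*} [Fintype α] [Fintype β] (f : α → γ) (g : β → γ)
    (h : Finset.univ.val.map f = Finset.univ.val.map g) : ∃ e : α ≃ β, ∀ a, g (e a) = f a := by
  classical
  have hcard : ∀ c, Nonempty ({a // f a = c} ≃ {b // g b = c}) := fun c => by
    have := congrArg (Multiset.count c) h
    rw [Multiset.count_map, Multiset.count_map] at this
    refine ⟨Fintype.equivOfCardEq ?_⟩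
    rw [Fintype.card_subtype, Fintype.card_subtype]
    simpa only [eq_comm, Finset.card_def, Finset.filter_val] using this
  refine ⟨(Equiv.sigmaFiberEquiv f).symm.trans
    ((Equiv.sigmaCongrRight fun c => (hcard c).some).trans (Equiv.sigmaFiberEquiv g)), fun a => ?_⟩
  exact ((hcard (f a)).some ⟨a, rfl⟩).2

section Compositions

variable {n : ℕ}

theorem index_mono (c : Composition n) {i j : Fin n} (h : i ≤ j) : c.index i ≤ c.index j := by
  by_contra hlt
  rw [not_le] at hlt
  have h1 := c.monotone_sizeUpTo (show (c.index j : ℕ) + 1 ≤ c.index i from hlt)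
  have h2 := c.sizeUpTo_index_le i
  have h3 : (j : ℕ) < c.sizeUpTo ((c.index j : ℕ) + 1) := c.lt_sizeUpTo_index_succ j
  have h4 : (i : ℕ) ≤ j := h
  omega

/-- The set of nodes `i` of the extended diagram such that `i` and `i + 1` lie in the same block
of the composition `c`, regarded as a decomposition of `Fin n` into intervals. -/
def compSet (c : Composition n) : Finset (Fin n) :=
  Finset.univ.filter fun i => i.succ ∉ c.boundaries

theorem compSet_injective : Function.Injective (compSet : Composition n → Finset (Fin n)) := by
  intro c d h
  apply (compositionEquiv n).injective
  apply CompositionAsSet.ext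
  change c.toCompositionAsSet.boundaries = d.toCompositionAsSet.boundaries
  ext i
  refine Fin.cases ?_ (fun i => ?_) i
  · exact iff_of_true c.toCompositionAsSet.zero_mem d.toCompositionAsSet.zero_mem
  · have := Finset.ext_iff.mp h i
    simp only [compSet, Finset.mem_filter, Finset.mem_univ, true_and] at this
    exact not_iff_not.mp this

theorem card_compSet (c : Composition n) : (compSet c).card + c.length = n := by
  have h1 : (Finset.univ.filter fun i : Fin n => ¬ i.succ ∉ c.boundaries).card = c.length := by
    have : c.boundaries.erase 0 =
        (Finset.univ.filter fun i : Fin n => ¬ i.succ ∉ c.boundaries).map (Fin.succEmb n) := by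
      ext i
      refine Fin.cases (by simp) (fun i => ?_) i
      simp
    have h2 := congrArg Finset.card this
    rw [Finset.card_map, Finset.card_erase_of_mem
      (show 0 ∈ c.boundaries from c.toCompositionAsSet.zero_mem),
      c.card_boundaries_eq_succ_length] at h2
    omega
  have h2 := Finset.card_filter_add_card_filter_not (s := (Finset.univ : Finset (Fin n)))
    (fun i => i.succ ∉ c.boundaries)
  rw [h1, Finset.card_univ, Fintype.card_fin] at h2
  exact h2

theorem index_surjective (c : Composition n) : Function.Surjective c.index := fun t =>
  ⟨c.embedding t ⟨0, c.one_le_blocksFun t⟩, c.index_embedding t _⟩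

variable [NeZero n]

theorem val_neg_one : ((-1 : Fin n) : ℕ) + 1 = n := by
  obtain ⟨m, rfl⟩ := Nat.exists_eq_succ_of_ne_zero (NeZero.ne n)
  rw [Fin.coe_neg_one]

theorem val_add_one_of_lt {i : Fin n} (h : (i : ℕ) + 1 < n) : ((i + 1 : Fin n) : ℕ) = i + 1 := by
  obtain ⟨m, rfl⟩ := Nat.exists_eq_succ_of_ne_zero (NeZero.ne n)
  exact Fin.val_add_one_of_lt (Fin.lt_def.mpr (by simpa using h))

theorem neg_one_notMem_compSet (c : Composition n) : -1 ∉ compSet c := by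
  simp only [compSet, Finset.mem_filter, Finset.mem_univ, true_and, not_not]
  have : (-1 : Fin n).succ = Fin.last n := Fin.ext (by simpa using val_neg_one)
  rw [this]
  exact c.toCompositionAsSet.getLast_mem

theorem exists_compSet_eq {J : Finset (Fin n)} (hJ : -1 ∉ J) : ∃ c, compSet c = J := by
  let B : CompositionAsSet n :=
    { boundaries := insert 0 (Jᶜ.map (Fin.succEmb n))
      zero_mem := Finset.mem_insert_self _ _
      getLast_mem := by
        refine Finset.mem_insert_of_mem (Finset.mem_map.mpr ⟨-1, by simpa using hJ, ?_⟩)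
        exact Fin.ext (by simpa using val_neg_one) }
  refine ⟨B.toComposition, ?_⟩
  ext i
  simp [compSet, B.toComposition_boundaries, B]

theorem mem_compSet_iff (c : Composition n) (i : Fin n) :
    i ∈ compSet c ↔ (i : ℕ) + 1 < n ∧ c.index (i + 1) = c.index i := by
  have h1 := c.sizeUpTo_index_le i
  have h2 : (i : ℕ) < c.sizeUpTo ((c.index i : ℕ) + 1) := c.lt_sizeUpTo_index_succ i
  constructor
  · intro h
    have hlt : (i : ℕ) + 1 < n := by
      refine lt_of_le_of_ne i.2 fun hi => neg_one_notMem_compSet c ?_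
      have : i = -1 := Fin.ext (by have := val_neg_one (n := n); omega)
      exact this ▸ h
    refine ⟨hlt, ?_⟩
    symm
    rw [← c.mem_range_embedding_iff', c.mem_range_embedding_iff, val_add_one_of_lt hlt]
    refine ⟨by omega, lt_of_le_of_ne h2 fun he => ?_⟩
    simp only [compSet, Finset.mem_filter, Finset.mem_univ, true_and] at h
    exact h (Finset.mem_map.mpr ⟨(c.index i).succ, Finset.mem_univ _, Fin.ext he.symm⟩)
  · rintro ⟨hlt, h⟩
    simp only [compSet, Finset.mem_filter, Finset.mem_univ, true_and]
    intro hmem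
    obtain ⟨t, -, ht⟩ := Finset.mem_map.mp hmem
    have ht : c.sizeUpTo t = i + 1 := congrArg Fin.val ht
    have h3 : ((i + 1 : Fin n) : ℕ) < c.sizeUpTo ((c.index (i + 1) : ℕ) + 1) :=
      c.lt_sizeUpTo_index_succ (i + 1)
    rw [h, val_add_one_of_lt hlt] at h3
    have h4 : (c.index i : ℕ) + 1 ≤ t := by
      by_contra hle
      have := c.monotone_sizeUpTo (show (t : ℕ) ≤ c.index i by omega)
      omega
    have := c.monotone_sizeUpTo h4
    omega

theorem linked_compSet_iff (c : Composition n) (i j : Fin n) :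
    Linked (compSet c) i j ↔ c.index i = c.index j := by
  constructor
  · intro h
    induction h with
    | rel x y hxy =>
      obtain ⟨hx, rfl⟩ := hxy
      exact ((mem_compSet_iff c x).mp hx).2.symm
    | refl x => rfl
    | symm x y _ ih => exact ih.symm
    | trans x y z _ _ ih1 ih2 => exact ih1.trans ih2
  · have key : ∀ k : ℕ, ∀ i j : Fin n, (j : ℕ) = i + k → c.index i = c.index j →
        Linked (compSet c) i j := by
      intro k
      induction k with
      | zero =>
        intro i j hij _
        rw [Fin.ext (show (i : ℕ) = j by omega)]
        exact Relation.EqvGen.refl _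
      | succ k ih =>
        intro i j hij h
        have hlt : (i : ℕ) + 1 < n := by omega
        have hv := val_add_one_of_lt hlt
        have h1 : c.index (i + 1) = c.index i := le_antisymm
          (h ▸ index_mono c (Fin.le_def.mpr (by omega))) (index_mono c (Fin.le_def.mpr (by omega)))
        exact (Relation.EqvGen.rel _ _ ⟨(mem_compSet_iff c i).mpr ⟨hlt, h1⟩, rfl⟩).trans _ _ _
          (ih (i + 1) j (by omega) (h1.trans h))
    intro h
    rcases le_total i j with hij | hij
    · exact key (j - i) i j (by have := Fin.le_def.mp hij; omega) h
    · exact (key (i - j) j i (by have := Fin.le_def.mp hij; omega) h.symm).symm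

theorem blockSizes_compSet (c : Composition n) : blockSizes (compSet c) = c.blocks := by
  rw [blockSizes_eq_map (index_surjective c) (linked_compSet_iff c), ← c.ofFn_blocksFun,
    ← Fin.univ_val_map]
  refine Multiset.map_congr rfl fun t _ => ?_
  have : (Finset.univ.filter fun i => c.index i = t) =
      Finset.univ.map (c.embedding t).toEmbedding := by
    ext i
    have := c.mem_range_embedding_iff' (j := i) (i := t)
    simpa [eq_comm] using this.symm
  rw [this, Finset.card_map, Finset.card_univ, Fintype.card_fin]

/-- Compositions with the same blocks up to order define conjugate subsets: the blocks can be
permuted as intervals. -/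
theorem exists_isLinkIso_compSet {c d : Composition n}
    (h : (c.blocks : Multiset ℕ) = d.blocks) : ∃ σ, IsLinkIso σ (compSet c) (compSet d) := by
  rw [← c.ofFn_blocksFun, ← d.ofFn_blocksFun, ← Fin.univ_val_map, ← Fin.univ_val_map] at h
  obtain ⟨e, he⟩ := exists_equiv_of_map_eq _ _ h
  let σ : Equiv.Perm (Fin n) := c.blocksFinEquiv.symm.trans
    ((Equiv.sigmaCongr e fun t => finCongr (he t).symm).trans d.blocksFinEquiv)
  have hidx : ∀ i, d.index (σ i) = e (c.index i) := fun i => d.index_embedding _ _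
  have hval : ∀ i, (σ i : ℕ) + c.sizeUpTo (c.index i) = d.sizeUpTo (e (c.index i)) + i := by
    intro i
    have h1 : (σ i : ℕ) = d.sizeUpTo (e (c.index i)) + (i - c.sizeUpTo (c.index i)) := rfl
    have h2 := c.sizeUpTo_index_le i
    omega
  have key : ∀ {c d : Composition n} {σ : Equiv.Perm (Fin n)} {e : Fin c.length ≃ Fin d.length},
      (∀ i, d.index (σ i) = e (c.index i)) →
      (∀ i, (σ i : ℕ) + c.sizeUpTo (c.index i) = d.sizeUpTo (e (c.index i)) + i) →
      ∀ i ∈ compSet c, σ i ∈ compSet d ∧ σ (i + 1) = σ i + 1 := by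
    intro c d σ e hidx hval i hi
    obtain ⟨hlt, h⟩ := (mem_compSet_iff c i).mp hi
    have h1 := hval i
    have h2 := hval (i + 1)
    rw [h, val_add_one_of_lt hlt] at h2
    have h3 : (σ (i + 1) : ℕ) = σ i + 1 := by omega
    have h4 : (σ i : ℕ) + 1 < n := h3 ▸ (σ (i + 1)).2
    have h5 : σ (i + 1) = σ i + 1 := Fin.ext (by rw [h3, val_add_one_of_lt h4])
    exact ⟨(mem_compSet_iff d _).mpr ⟨h4, by rw [← h5, hidx, hidx, h]⟩, h5⟩
  refine ⟨σ, key hidx hval, key (e := e.symm) (fun j => ?_) fun j => ?_⟩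
  · have := hidx (σ⁻¹ j)
    rw [← Equiv.Perm.mul_apply, mul_inv_cancel, Equiv.Perm.one_apply] at this
    rw [this, Equiv.symm_apply_apply]
  · have h1 := hidx (σ⁻¹ j)
    have h2 := hval (σ⁻¹ j)
    rw [← Equiv.Perm.mul_apply, mul_inv_cancel, Equiv.Perm.one_apply] at h1 h2
    rw [h1, Equiv.symm_apply_apply]
    omega

/-- Every proper subset of the extended diagram can be rotated so as to come from a
composition. -/
theorem exists_isLinkIso_to_compSet {J : Finset (Fin n)} (hJ : J ≠ Finset.univ) :
    ∃ c σ, IsLinkIso σ J (compSet c) := by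
  obtain ⟨a, ha⟩ : ∃ a, a ∉ J := by
    by_contra! h
    exact hJ (Finset.eq_univ_iff_forall.mpr h)
  obtain ⟨c, hc⟩ : ∃ c, compSet c = J.map (Equiv.addRight (-1 - a)).toEmbedding := by
    refine exists_compSet_eq fun h => ha ?_
    obtain ⟨i, hi, h⟩ := Finset.mem_map.mp h
    have : i + (-1 - a) = -1 := h
    have : i = a := by rw [eq_sub_of_add_eq this, sub_sub_cancel]
    exact this ▸ hi
  exact ⟨c, _, hc ▸ isLinkIso_rotate _ J⟩

theorem exists_isLinkIso_of_blockSizes_eq {S J : Finset (Fin n)} (hS : S ≠ Finset.univ)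
    (hJ : J ≠ Finset.univ) (h : blockSizes S = blockSizes J) : ∃ σ, IsLinkIso σ S J := by
  obtain ⟨c, σ, hσ⟩ := exists_isLinkIso_to_compSet hS
  obtain ⟨d, τ, hτ⟩ := exists_isLinkIso_to_compSet hJ
  obtain ⟨ρ, hρ⟩ : ∃ ρ, IsLinkIso ρ (compSet c) (compSet d) := by
    apply exists_isLinkIso_compSet
    rw [← blockSizes_compSet, ← blockSizes_compSet, ← hσ.blockSizes_eq, h, hτ.blockSizes_eq]
  exact ⟨_, hτ.inv.mul (hρ.mul hσ)⟩

theorem compSet_ne_univ (c : Composition n) : compSet c ≠ Finset.univ := fun h =>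
  neg_one_notMem_compSet c (h ▸ Finset.mem_univ _)

/-- A proper subset `J` has `n - |J|` blocks. -/
theorem card_add_card_blockSizes {J : Finset (Fin n)} (hJ : J ≠ Finset.univ) :
    J.card + (blockSizes J).card = n := by
  obtain ⟨c, σ, hσ⟩ := exists_isLinkIso_to_compSet hJ
  rw [hσ.blockSizes_eq, hσ.card_eq, blockSizes_compSet, Multiset.coe_card, c.blocks_length,
    card_compSet]

theorem exists_blockSizes_eq (lam : n.Partition) :
    ∃ J : Finset (Fin n), J ≠ Finset.univ ∧ blockSizes J = lam.parts := by
  let c : Composition n := ⟨lam.parts.toList, fun h => lam.parts_pos (Multiset.mem_toList.mp h), by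
    rw [Multiset.sum_toList, lam.parts_sum]⟩
  exact ⟨compSet c, compSet_ne_univ c, by rw [blockSizes_compSet]; exact lam.parts.coe_toList⟩

theorem exists_partition_eq_blockSizes {J : Finset (Fin n)} (hJ : J ≠ Finset.univ) :
    ∃ lam : n.Partition, blockSizes J = lam.parts := by
  obtain ⟨c, σ, hσ⟩ := exists_isLinkIso_to_compSet hJ
  exact ⟨Nat.Partition.ofComposition n c, by rw [hσ.blockSizes_eq, blockSizes_compSet]; rfl⟩

end Compositions

/-! ### Marks, positive solutions and the connection index in type `A` -/

section TypeAInvariants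

variable {n : ℕ} [NeZero n]

omit [NeZero n] in
theorem stdVec_apply (i j : Fin n) :
    (stdVec i : EuclideanSpace ℝ (Fin n)) j = if j = i then 1 else 0 := by
  simp [stdVec]

theorem mark_eq_one (i : Fin n) : mark n i = 1 := by
  obtain ⟨h1, h2⟩ : IsMarks n (mark n) := Classical.choose_spec (exists_isMarks n)
  have hstep : ∀ j, mark n (j + 1) = mark n j := by
    intro j
    have := congrArg (fun v : EuclideanSpace ℝ (Fin n) => v (j + 1)) h1
    simp only [extSimpleRoot_eq, WithLp.ofLp_sum, Finset.sum_apply, PiLp.smul_apply,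
      PiLp.sub_apply, stdVec_apply, add_left_inj, smul_sub, Finset.sum_sub_distrib,
      PiLp.zero_apply] at this
    simp only [nsmul_eq_mul, mul_ite, mul_one, mul_zero, Finset.sum_ite_eq, Finset.mem_univ,
      if_true, sub_eq_zero] at this
    exact_mod_cast this
  have hall : ∀ k : ℕ, ∀ i : Fin n, (i : ℕ) = k → mark n i = 1 := by
    intro k
    induction k with
    | zero =>
      intro i hi
      rw [← h2, ← hstep (-1), neg_add_cancel]
      exact congrArg _ (Fin.ext hi)
    | succ k ih =>
      intro i hi
      have hk : k + 1 < n := hi ▸ i.2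
      rw [show i = (⟨k, by omega⟩ : Fin n) + 1 from
        Fin.ext (by rw [val_add_one_of_lt (i := ⟨k, by omega⟩) hk, hi]), hstep]
      exact ih _ rfl
  exact hall i i rfl

/-- The number of compositions of `t ≥ 1` into positive parts indexed by `ι`. -/
theorem card_positive_solutions (ι : Type*) [Fintype ι] [Nonempty ι] {t : ℕ} (ht : 1 ≤ t) :
    Nat.card {y : ι → ℕ+ // ∑ i, (y i : ℕ) = t} = (t - 1).choose (Fintype.card ι - 1) := by
  classical
  have hm : 0 < Fintype.card ι := Fintype.card_pos
  rcases lt_or_ge t (Fintype.card ι) with hlt | hge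
  · rw [Nat.choose_eq_zero_of_lt (by omega), Nat.card_eq_zero]
    refine Or.inl ⟨fun y => ?_⟩
    have : ∑ _i : ι, 1 ≤ ∑ i, (y.1 i : ℕ) := Finset.sum_le_sum fun i _ => (y.1 i).2
    rw [y.2, Finset.sum_const, Finset.card_univ, smul_eq_mul] at this
    omega
  · have e : {y : ι → ℕ+ // ∑ i, (y i : ℕ) = t} ≃
        {P : ι → ℕ // ∑ i, P i = t - Fintype.card ι} := by
      refine (Equiv.arrowCongr (Equiv.refl ι) Equiv.pnatEquivNat).subtypeEquiv fun y => ?_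
      have : ∑ i, (y i : ℕ) = ∑ i, (y i).natPred + Fintype.card ι := by
        rw [← Finset.card_univ, Finset.card_eq_sum_ones, ← Finset.sum_add_distrib]
        exact Finset.sum_congr rfl fun i _ => (PNat.natPred_add_one _).symm
      rw [this]
      change _ ↔ ∑ i, (y i).natPred = _
      omega
    rw [Nat.card_congr (e.trans (Sym.equivNatSumOfFintype ι _).symm), Nat.card_eq_fintype_card,
      Sym.card_sym_eq_choose, ← Nat.choose_symm (by omega)]
    congr 1 <;> omega

theorem numSolutions_eq {S : Finset (Fin n)} (hS : S ≠ Finset.univ) {t : ℕ} (ht : 1 ≤ t) :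
    numSolutions S t = (t - 1).choose (n - S.card - 1) := by
  obtain ⟨a, ha⟩ : ∃ a, a ∉ S := by
    by_contra! h
    exact hS (Finset.eq_univ_iff_forall.mpr h)
  have : Nonempty {i : Fin n // i ∉ S} := ⟨⟨a, ha⟩⟩
  have hc : Fintype.card {i : Fin n // i ∉ S} = n - S.card := by
    rw [Fintype.card_subtype_compl, Fintype.card_fin, Fintype.card_coe]
  have := card_positive_solutions {i : Fin n // i ∉ S} ht
  rw [hc] at this
  simpa only [numSolutions, mark_eq_one, one_mul] using this

omit [NeZero n] in
theorem coroot_eq {α : EuclideanSpace ℝ (Fin n)} (h : α ∈ roots n) : coroot α = α := by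
  obtain ⟨i, j, hij, rfl⟩ := h
  have : ⟪(stdVec i - stdVec j : EuclideanSpace ℝ (Fin n)), stdVec i - stdVec j⟫ = 2 := by
    simp only [inner_sub_left, inner_sub_right, inner_stdVec, if_neg hij, if_neg hij.symm]
    norm_num
  rw [coroot, this, div_self two_ne_zero, one_smul]

omit [NeZero n] in
theorem eq_sum_stdVec (v : EuclideanSpace ℝ (Fin n)) : v = ∑ i, v i • stdVec i := by
  ext j
  simp [WithLp.ofLp_sum, stdVec_apply]

omit [NeZero n] in
theorem sum_eq_zero_of_mem_span {v : EuclideanSpace ℝ (Fin n)}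
    (hv : v ∈ Submodule.span ℝ (roots n)) : ∑ i, v i = 0 := by
  induction hv using Submodule.span_induction with
  | mem x hx =>
    obtain ⟨i, j, -, rfl⟩ := hx
    simp [stdVec_apply]
  | zero => simp
  | add x y _ _ hx hy => simp [Finset.sum_add_distrib, hx, hy]
  | smul c x _ hx => simp [← Finset.mul_sum, hx]

omit [NeZero n] in
theorem inner_stdVec_sub (v : EuclideanSpace ℝ (Fin n)) (i j : Fin n) :
    ⟪v, stdVec i - stdVec j⟫ = v i - v j := by
  simp [inner_sub_right, stdVec, EuclideanSpace.inner_single_right]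

theorem mem_coweightLattice_iff (v : EuclideanSpace ℝ (Fin n)) :
    v ∈ coweightLattice (roots n) ↔ ∑ i, v i = 0 ∧ ∀ i, ∃ m : ℤ, v i - v 0 = m := by
  constructor
  · rintro ⟨h1, h2⟩
    refine ⟨sum_eq_zero_of_mem_span h1, fun i => ?_⟩
    by_cases hi : i = 0
    · exact ⟨0, by simp [hi]⟩
    · obtain ⟨m, hm⟩ := h2 _ ⟨i, 0, hi, rfl⟩
      exact ⟨m, by rw [← hm, inner_stdVec_sub]⟩
  · rintro ⟨h1, h2⟩
    constructor
    · have hv : v = ∑ i, v i • (stdVec i - stdVec 0) := by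
        simp only [smul_sub, Finset.sum_sub_distrib, ← Finset.sum_smul, h1, zero_smul, sub_zero]
        exact eq_sum_stdVec v
      rw [hv]
      refine sum_mem fun i _ => Submodule.smul_mem _ _ ?_
      by_cases hi : i = 0
      · simp [hi]
      · exact Submodule.subset_span ⟨i, 0, hi, rfl⟩
    · rintro _ ⟨i, j, -, rfl⟩
      obtain ⟨a, ha⟩ := h2 i
      obtain ⟨b, hb⟩ := h2 j
      exact ⟨a - b, by rw [inner_stdVec_sub]; push_cast; rw [← ha, ← hb]; ring⟩

theorem mem_corootLattice_iff (v : EuclideanSpace ℝ (Fin n)) :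
    v ∈ corootLattice (roots n) ↔ ∑ i, v i = 0 ∧ ∀ i, ∃ m : ℤ, v i = m := by
  constructor
  · intro hv
    unfold corootLattice at hv
    induction hv using AddSubgroup.closure_induction with
    | mem x hx =>
      obtain ⟨α, hα, rfl⟩ := hx
      rw [coroot_eq hα]
      refine ⟨sum_eq_zero_of_mem_span (Submodule.subset_span hα), fun l => ?_⟩
      obtain ⟨i, j, -, rfl⟩ := hα
      exact ⟨(if l = i then 1 else 0) - if l = j then 1 else 0, by simp [stdVec_apply]⟩
    | zero => exact ⟨by simp, fun i => ⟨0, by simp⟩⟩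
    | add x y _ _ hx hy =>
      refine ⟨by simp [Finset.sum_add_distrib, hx.1, hy.1], fun i => ?_⟩
      obtain ⟨a, ha⟩ := hx.2 i
      obtain ⟨b, hb⟩ := hy.2 i
      exact ⟨a + b, by simp [ha, hb]⟩
    | neg x _ hx =>
      refine ⟨by simp [hx.1], fun i => ?_⟩
      obtain ⟨a, ha⟩ := hx.2 i
      exact ⟨-a, by simp [ha]⟩
  · rintro ⟨h1, h2⟩
    choose m hm using h2
    have hv : v = ∑ i, m i • (stdVec i - stdVec 0) := by
      have : ∀ i, m i • (stdVec i - stdVec 0 : EuclideanSpace ℝ (Fin n)) =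
          v i • (stdVec i - stdVec 0) := fun i => by rw [hm, Int.cast_smul_eq_zsmul]
      simp only [this, smul_sub, Finset.sum_sub_distrib, ← Finset.sum_smul, h1, zero_smul, sub_zero]
      exact eq_sum_stdVec v
    rw [hv]
    refine sum_mem fun i _ => AddSubgroup.zsmul_mem _ ?_ _
    by_cases hi : i = 0
    · rw [hi, sub_self]; exact zero_mem _
    · have : (stdVec i - stdVec 0 : EuclideanSpace ℝ (Fin n)) ∈ roots n := ⟨i, 0, hi, rfl⟩
      exact AddSubgroup.subset_closure ⟨_, this, coroot_eq this⟩

/-- In type `A_{n-1}` the index `[L̂ : L]` is `n`: the map `v ↦ n v_0 mod n` is a surjection of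
`L̂` onto `ℤ/n` with kernel `L`. -/
theorem connectionIndex_eq : connectionIndex (roots n) = n := by
  have hn0 : (n : ℝ) ≠ 0 := Nat.cast_ne_zero.mpr (NeZero.ne n)
  have hint : ∀ v : coweightLattice (roots n), ((⌊(n : ℝ) * v.1 0⌋ : ℤ) : ℝ) = n * v.1 0 := by
    intro v
    obtain ⟨h1, h2⟩ := (mem_coweightLattice_iff v.1).mp v.2
    choose m hm using h2
    have : (n : ℝ) * v.1 0 = ((-∑ i, m i : ℤ) : ℝ) := by
      have h3 : ∑ i, v.1 i - ∑ _i : Fin n, v.1 0 = ∑ i, (m i : ℝ) := by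
        rw [← Finset.sum_sub_distrib]
        exact Finset.sum_congr rfl fun i _ => hm i
      rw [h1, Finset.sum_const, Finset.card_univ, Fintype.card_fin, nsmul_eq_mul] at h3
      push_cast
      linarith
    rw [this, Int.floor_intCast]
  let φ : coweightLattice (roots n) →+ ZMod n :=
    (Int.castAddHom (ZMod n)).comp (AddMonoidHom.mk' (fun v => ⌊(n : ℝ) * v.1 0⌋) fun v w => by
      have h : ((⌊(n : ℝ) * (v + w).1 0⌋ : ℤ) : ℝ) =
          ((⌊(n : ℝ) * v.1 0⌋ + ⌊(n : ℝ) * w.1 0⌋ : ℤ) : ℝ) := by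
        rw [hint]
        push_cast
        rw [hint, hint, ← mul_add]
        rfl
      exact_mod_cast h)
  have hφ : ∀ v, φ v = ((⌊(n : ℝ) * v.1 0⌋ : ℤ) : ZMod n) := fun v => rfl
  have hker : (corootLattice (roots n)).addSubgroupOf (coweightLattice (roots n)) = φ.ker := by
    ext v
    rw [AddSubgroup.mem_addSubgroupOf, AddMonoidHom.mem_ker, hφ, mem_corootLattice_iff,
      ZMod.intCast_zmod_eq_zero_iff_dvd]
    obtain ⟨h1, h2⟩ := (mem_coweightLattice_iff v.1).mp v.2
    constructor
    · rintro ⟨-, h⟩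
      obtain ⟨m, hm⟩ := h 0
      refine ⟨m, ?_⟩
      have := hint v
      rw [hm] at this ⊢
      exact_mod_cast this
    · rintro ⟨m, hm⟩
      have h0 : v.1 0 = m := by
        have := hint v
        rw [hm] at this
        push_cast at this
        exact (mul_left_cancel₀ hn0 this).symm
      refine ⟨h1, fun i => ?_⟩
      obtain ⟨l, hl⟩ := h2 i
      exact ⟨l + m, by push_cast; rw [← hl, ← h0]; ring⟩
  have hsurj : Function.Surjective φ := by
    intro z
    obtain ⟨m, rfl⟩ := ZMod.intCast_surjective z
    -- the coweight `-m (ε_0 - (1/n) ∑ ε_i)`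
    let v : EuclideanSpace ℝ (Fin n) := WithLp.toLp 2 fun i =>
      (m : ℝ) / n - if i = 0 then (m : ℝ) else 0
    have hv : ∀ i, v i = (m : ℝ) / n - if i = 0 then (m : ℝ) else 0 := fun i => rfl
    have hmem : v ∈ coweightLattice (roots n) := by
      rw [mem_coweightLattice_iff]
      constructor
      · simp only [hv, Finset.sum_sub_distrib, Finset.sum_const, Finset.card_univ,
          Fintype.card_fin, Finset.sum_ite_eq', Finset.mem_univ, if_true, nsmul_eq_mul]
        field_simp
        ring
      · intro i
        refine ⟨m - if i = 0 then m else 0, ?_⟩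
        rw [hv, hv, if_pos rfl]
        split_ifs <;> simp
    refine ⟨⟨v, hmem⟩, ?_⟩
    have h := hint ⟨v, hmem⟩
    have h' : (⌊(n : ℝ) * v 0⌋ : ℤ) = m - n * m := by
      have : ((⌊(n : ℝ) * v 0⌋ : ℤ) : ℝ) = ((m - n * m : ℤ) : ℝ) := by
        refine h.trans ?_
        rw [hv, if_pos rfl]
        push_cast
        field_simp
      exact_mod_cast this
    rw [hφ]
    change ((⌊(n : ℝ) * v 0⌋ : ℤ) : ZMod n) = m
    rw [h']
    simp
  rw [connectionIndex, AddSubgroup.relIndex, hker, AddSubgroup.index_ker,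
    AddMonoidHom.range_eq_top.mpr hsurj, AddSubgroup.card_top, Nat.card_zmod]

end TypeAInvariants

/-! ### Counting the subsets with given block sizes -/

theorem exists_perm_ofFn_comp_eq {α : Type*} {s : ℕ} (f : Fin s → α) (l : List α)
    (h : (l : Multiset α) = (List.ofFn f : List α)) :
    ∃ π : Equiv.Perm (Fin s), List.ofFn (f ∘ π) = l := by
  have hlen : l.length = s := by
    have := congrArg Multiset.card h
    simpa using this
  subst hlen
  have hl : List.ofFn l.get = l := List.ofFn_get l
  replace h : Finset.univ.val.map l.get = Finset.univ.val.map f := by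
    rw [Fin.univ_val_map, Fin.univ_val_map, hl]
    exact h
  obtain ⟨π, hπ⟩ := exists_equiv_of_map_eq _ _ h
  refine ⟨π, ?_⟩
  conv_rhs => rw [← hl]
  exact congrArg _ (funext hπ)

/-- The order of the stabilizer of `f`. The product may run over all of `{1, …, n}`, since a value
that is not attained contributes `0! = 1`. -/
theorem card_perm_preserving {ι : Type*} [Fintype ι] [DecidableEq ι] {n : ℕ} (f : ι → ℕ)
    (hf : ∀ t, f t ∈ Finset.Icc 1 n) :
    (Finset.univ.filter fun π : Equiv.Perm ι => f ∘ π = f).card =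
      ∏ i ∈ Finset.Icc 1 n, ((Finset.univ.val.map f).count i).factorial := by
  rw [← Fintype.card_subtype, DomMulAct.stabilizer_card']
  have hsub : Finset.univ.image f ⊆ Finset.Icc 1 n := fun i hi => by
    obtain ⟨t, -, rfl⟩ := Finset.mem_image.mp hi
    exact hf t
  rw [← Finset.prod_subset hsub]
  · refine Finset.prod_congr rfl fun i _ => ?_
    rw [Fintype.card_subtype, Multiset.count_map]
    simp only [eq_comm, Finset.card_def, Finset.filter_val]
  · intro i _ hi
    have : (Finset.univ.val.map f).count i = 0 := by
      rw [Multiset.count_eq_zero]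
      simpa using hi
    rw [this, Nat.factorial_zero]

/-- The number of compositions with prescribed multiset of parts is a multinomial coefficient. -/
theorem card_compositions_mul {n : ℕ} (c₀ : Composition n) :
    (Finset.univ.filter fun c : Composition n => (c.blocks : Multiset ℕ) = c₀.blocks).card *
      ∏ i ∈ Finset.Icc 1 n, ((c₀.blocks : Multiset ℕ).count i).factorial = c₀.length.factorial := by
  classical
  let f := c₀.blocksFun
  have hf : (List.ofFn f : Multiset ℕ) = c₀.blocks := by rw [← c₀.ofFn_blocksFun]
  have hcomp : ∀ π : Equiv.Perm (Fin c₀.length),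
      (List.ofFn (f ∘ π) : Multiset ℕ) = c₀.blocks := fun π => by
    rw [← hf]; exact Multiset.coe_eq_coe.mpr (π.ofFn_comp_perm f)
  let Φ : Equiv.Perm (Fin c₀.length) → Composition n := fun π =>
    ⟨List.ofFn (f ∘ π), fun h => c₀.blocks_pos (Multiset.mem_coe.mp
      (hcomp π ▸ Multiset.mem_coe.mpr h)), by
      rw [← Multiset.sum_coe, hcomp, Multiset.sum_coe, c₀.blocks_sum]⟩
  have hcard := Finset.card_eq_sum_card_fiberwise (f := Φ) (s := Finset.univ)
    (t := Finset.univ.filter fun c : Composition n => (c.blocks : Multiset ℕ) = c₀.blocks)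
    (fun π _ => by simpa using hcomp π)
  rw [Finset.card_univ, Fintype.card_perm, Fintype.card_fin] at hcard
  rw [hcard, ← smul_eq_mul, ← Finset.sum_const]
  refine Finset.sum_congr rfl fun c hc => ?_
  have hc : (c.blocks : Multiset ℕ) = c₀.blocks := by simpa using hc
  obtain ⟨π₀, hπ₀⟩ := exists_perm_ofFn_comp_eq f c.blocks (by rw [hc, hf])
  have h2 := card_perm_preserving (n := n) f fun t =>
    Finset.mem_Icc.mpr ⟨c₀.one_le_blocksFun t, c₀.blocksFun_le t⟩
  rw [Fin.univ_val_map, hf] at h2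
  rw [← h2]
  refine Finset.card_bij (fun π _ => π * π₀) (fun π hπ => ?_) (fun π _ ρ _ h => mul_right_cancel h)
    fun π hπ => ⟨π * π₀⁻¹, ?_, by simp⟩
  · have hπ : f ∘ π = f := by simpa using hπ
    rw [Finset.mem_filter]
    refine ⟨Finset.mem_univ _, Composition.ext ?_⟩
    change List.ofFn (f ∘ π ∘ π₀) = _
    rw [← Function.comp_assoc, hπ, hπ₀]
  · have hπ : List.ofFn (f ∘ π) = c.blocks := by
      have := (Finset.mem_filter.mp hπ).2
      exact congrArg Composition.blocks this
    rw [← hπ₀] at hπ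
    have hπ := List.ofFn_injective hπ
    rw [Finset.mem_filter]
    refine ⟨Finset.mem_univ _, ?_⟩
    change (f ∘ π) ∘ ⇑π₀⁻¹ = f
    rw [hπ]
    ext t
    simp

section Count

variable {n : ℕ} [NeZero n]

open Classical in
/-- Double counting of the pairs `(S, c)` with `c ∉ S ∼ J`: rotating `c` to the last node turns
`S` into a composition. -/
theorem card_wEquiv_mul (hn : 2 ≤ n) {J : Finset (Fin n)} (hJ : J ≠ Finset.univ) :
    (Finset.univ.filter fun S : Finset (Fin n) => S ≠ Finset.univ ∧ WEquiv S J).card *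
        (n - J.card) =
      n * (Finset.univ.filter fun c : Composition n =>
        (c.blocks : Multiset ℕ) = blockSizes J).card := by
  set A := Finset.univ.filter fun S : Finset (Fin n) => S ≠ Finset.univ ∧ WEquiv S J with hA
  have hrot : ∀ (r : Fin n) (S : Finset (Fin n)), S ∈ A →
      S.map (Equiv.addRight r).toEmbedding ∈ A := by
    intro r S hS
    simp only [hA, Finset.mem_filter, Finset.mem_univ, true_and, wEquiv_iff hn] at hS ⊢
    obtain ⟨h1, σ, hσ⟩ := hS
    have := isLinkIso_rotate r S
    exact ⟨this.inv.ne_univ h1, _, hσ.mul this.inv⟩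
  have hcompl : ∀ S ∈ A, (Sᶜ).card = n - J.card := by
    intro S hS
    simp only [hA, Finset.mem_filter, Finset.mem_univ, true_and, wEquiv_iff hn] at hS
    obtain ⟨-, σ, hσ⟩ := hS
    rw [Finset.card_compl, Fintype.card_fin, hσ.card_eq]
  have hlast : ∀ r : Fin n, (A.filter fun S => r ∉ S).card = (A.filter fun S => -1 ∉ S).card := by
    intro r
    refine Finset.card_bij' (fun S _ => S.map (Equiv.addRight (-1 - r)).toEmbedding)
      (fun S _ => S.map (Equiv.addRight (r - -1)).toEmbedding) ?_ ?_ ?_ ?_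
    · intro S hS
      rw [Finset.mem_filter] at hS ⊢
      refine ⟨hrot _ _ hS.1, fun h => hS.2 ?_⟩
      obtain ⟨i, hi, h⟩ := Finset.mem_map.mp h
      have h : i + (-1 - r) = -1 := h
      rw [eq_sub_of_add_eq h, sub_sub_cancel] at hi
      exact hi
    · intro S hS
      rw [Finset.mem_filter] at hS ⊢
      refine ⟨hrot _ _ hS.1, fun h => hS.2 ?_⟩
      obtain ⟨i, hi, h⟩ := Finset.mem_map.mp h
      have h : i + (r - -1) = r := h
      rw [eq_sub_of_add_eq h, sub_sub_cancel] at hi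
      exact hi
    · intro S _
      ext i
      have : i + (-1 + -r) + (r + 1) = i := by abel
      simp [Equiv.addRight, this]
    · intro S _
      ext i
      have : i + (r + 1) + (-1 + -r) = i := by abel
      simp [Equiv.addRight, this]
  have hK : (A.filter fun S => -1 ∉ S).card = (Finset.univ.filter fun c : Composition n =>
      (c.blocks : Multiset ℕ) = blockSizes J).card := by
    symm
    refine Finset.card_bij (fun c _ => compSet c) ?_ (fun c _ d _ h => compSet_injective h) ?_
    · intro c hc
      simp only [hA, Finset.mem_filter, Finset.mem_univ, true_and, wEquiv_iff hn] at hc ⊢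
      exact ⟨⟨compSet_ne_univ c, exists_isLinkIso_of_blockSizes_eq (compSet_ne_univ c) hJ
        ((blockSizes_compSet c).trans hc)⟩, neg_one_notMem_compSet c⟩
    · intro S hS
      simp only [hA, Finset.mem_filter, Finset.mem_univ, true_and, wEquiv_iff hn] at hS
      obtain ⟨⟨-, σ, hσ⟩, h⟩ := hS
      obtain ⟨c, rfl⟩ := exists_compSet_eq h
      refine ⟨c, ?_, rfl⟩
      rw [Finset.mem_filter, ← hσ.blockSizes_eq, blockSizes_compSet]
      exact ⟨Finset.mem_univ _, rfl⟩
  calc A.card * (n - J.card) = ∑ S ∈ A, (Sᶜ).card := by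
        rw [Finset.sum_congr rfl hcompl, Finset.sum_const, smul_eq_mul]
    _ = ∑ S ∈ A, ∑ r : Fin n, if r ∉ S then 1 else 0 := by
        refine Finset.sum_congr rfl fun S _ => ?_
        rw [Finset.sum_boole, Finset.compl_eq_univ_sdiff, Nat.cast_id]
        congr 1
        ext i
        simp
    _ = ∑ r : Fin n, (A.filter fun S => r ∉ S).card := by
        rw [Finset.sum_comm]
        simp only [Finset.sum_boole, Nat.cast_id]
    _ = _ := by
        simp only [hlast, hK, Finset.sum_const, Finset.card_univ, Fintype.card_fin, smul_eq_mul]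

theorem prod_sub_eq_descFactorial {q : ℕ} (hq : 1 ≤ q) (m : ℕ) :
    ∏ j ∈ Finset.Icc 1 m, ((q : ℚ) - (j : ℚ)) = ((q - 1).descFactorial m : ℚ) := by
  rw [← descPochhammer_eval_eq_descFactorial ℚ, descPochhammer_eval_eq_prod_range,
    Finset.range_eq_Ico, ← Finset.Ico_add_one_right_eq_Icc, Finset.prod_Ico_add' _ 0 m 1 |>.symm]
  · simp only [Nat.Ico_zero_eq_range]
    refine Finset.prod_congr rfl fun j _ => ?_
    push_cast [Nat.cast_sub hq]
    ring

theorem sommersSum_eq_genusCount (hn : 2 ≤ n) {J : Finset (Fin n)} (hJ : J ≠ Finset.univ)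
    {lam : n.Partition} (h : blockSizes J = lam.parts) {q : ℕ} (hq : 1 ≤ q) :
    sommersSum J q = genusCount lam q := by
  classical
  have hs := card_add_card_blockSizes hJ
  obtain ⟨c₀, σ, hσ⟩ := exists_isLinkIso_to_compSet hJ
  have hc₀ : (c₀.blocks : Multiset ℕ) = blockSizes J := by
    rw [hσ.blockSizes_eq, blockSizes_compSet]
  have hlen : c₀.length = lam.parts.card := by rw [← h, ← hc₀]; rfl
  have hpos : 0 < lam.parts.card := hlen ▸ c₀.length_pos_iff.mpr (by omega)
  have h1 := card_wEquiv_mul hn hJ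
  have h2 := card_compositions_mul c₀
  rw [hc₀, h, hlen] at h2
  rw [h] at h1 hs
  rw [show n - J.card = lam.parts.card by omega] at h1
  rw [sommersSum, connectionIndex_eq, genusCount, prod_sub_eq_descFactorial hq]
  have hsum : ∑ S ∈ Finset.univ.filter (fun S : Finset (Fin n) => S ≠ Finset.univ ∧ WEquiv S J),
      (numSolutions S q : ℚ) = (Finset.univ.filter (fun S : Finset (Fin n) =>
        S ≠ Finset.univ ∧ WEquiv S J)).card * ((q - 1).choose (lam.parts.card - 1) : ℚ) := by
    rw [← nsmul_eq_mul, ← Finset.sum_const]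
    refine Finset.sum_congr rfl fun S hS => ?_
    simp only [Finset.mem_filter, Finset.mem_univ, true_and, wEquiv_iff hn] at hS
    obtain ⟨hS, τ, hτ⟩ := hS
    rw [numSolutions_eq hS hq, hτ.card_eq, show n - J.card = lam.parts.card by omega]
  rw [hsum]
  obtain ⟨m, hm⟩ : ∃ m, lam.parts.card = m + 1 := ⟨lam.parts.card - 1, by omega⟩
  rw [hm] at h1 h2 ⊢
  rw [Nat.add_sub_cancel, Nat.descFactorial_eq_factorial_mul_choose]
  set N := (Finset.univ.filter (fun S : Finset (Fin n) => S ≠ Finset.univ ∧ WEquiv S J)).card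
  set K := (Finset.univ.filter fun c : Composition n => (c.blocks : Multiset ℕ) = lam.parts).card
  set P := ∏ i ∈ Finset.Icc 1 n, (lam.parts.count i).factorial with hP
  have hP0 : (P : ℚ) ≠ 0 :=
    Nat.cast_ne_zero.mpr (Finset.prod_ne_zero_iff.mpr fun i _ => Nat.factorial_ne_zero _)
  have hn0 : (n : ℚ) ≠ 0 := Nat.cast_ne_zero.mpr (by omega)
  have hNP : N * P = n * m.factorial := by
    apply Nat.eq_of_mul_eq_mul_right (Nat.succ_pos m)
    calc N * P * (m + 1) = N * (m + 1) * P := by ring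
      _ = n * (K * P) := by rw [h1]; ring
      _ = n * m.factorial * (m + 1) := by rw [h2, Nat.factorial_succ]; ring
  have hNP' : (N : ℚ) * P = n * m.factorial := by exact_mod_cast hNP
  have hP' : ∏ i ∈ Finset.Icc 1 n, ((lam.parts.count i).factorial : ℚ) = P := by
    rw [hP]; push_cast; rfl
  rw [hP', eq_div_iff hP0]
  push_cast
  field_simp
  linear_combination ((q - 1).choose m : ℚ) * hNP'

end Count

open Matrix

/-! ### Centralizers of diagonal matrices -/

section Centralizer

variable {n : ℕ} {k : Type*} [Field k]

theorem coe_inv_mul_coe (g : SpecialLinearGroup (Fin n) k) :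
    ((g⁻¹ : SpecialLinearGroup (Fin n) k) : Matrix (Fin n) (Fin n) k) * g = 1 :=
  congrArg Subtype.val (inv_mul_cancel g)

theorem coe_mul_coe_inv (g : SpecialLinearGroup (Fin n) k) :
    (g : Matrix (Fin n) (Fin n) k) * (g⁻¹ : SpecialLinearGroup (Fin n) k) = 1 :=
  congrArg Subtype.val (mul_inv_cancel g)

theorem adj_eq_iff (g : SpecialLinearGroup (Fin n) k) (x y : Matrix (Fin n) (Fin n) k) :
    adj g x = y ↔ (g : Matrix (Fin n) (Fin n) k) * x = y * g := by
  constructor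
  · rintro rfl
    rw [adj, Matrix.mul_assoc _ _ (g : Matrix (Fin n) (Fin n) k), coe_inv_mul_coe, Matrix.mul_one]
  · intro h
    rw [adj, h, Matrix.mul_assoc, coe_mul_coe_inv, Matrix.mul_one]

theorem mem_centralizer_iff (g : SpecialLinearGroup (Fin n) k) (x : Matrix (Fin n) (Fin n) k) :
    g ∈ centralizer x ↔ (g : Matrix (Fin n) (Fin n) k) * x = x * g := adj_eq_iff g x x

theorem mem_centralizer_diagonal_iff (g : SpecialLinearGroup (Fin n) k) (d : Fin n → k) :
    g ∈ centralizer (diagonal d) ↔ ∀ i j, d i ≠ d j → (g : Matrix (Fin n) (Fin n) k) i j = 0 := by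
  rw [mem_centralizer_iff, ← Matrix.ext_iff]
  refine forall_congr' fun i => forall_congr' fun j => ?_
  rw [mul_diagonal, diagonal_mul, mul_comm, ← sub_eq_zero, ← sub_mul, mul_eq_zero, sub_eq_zero,
    or_iff_not_imp_left, eq_comm]

theorem transvection_mem_centralizer_diagonal_iff {i j : Fin n} (hij : i ≠ j) {c : k} (hc : c ≠ 0)
    (d : Fin n → k) :
    SpecialLinearGroup.transvection hij c ∈ centralizer (diagonal d) ↔ d i = d j := by
  rw [mem_centralizer_diagonal_iff]
  have hentry : ∀ a b, (SpecialLinearGroup.transvection hij c : Matrix (Fin n) (Fin n) k) a b =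
      (1 : Matrix (Fin n) (Fin n) k) a b + single i j c a b := fun a b => rfl
  constructor
  · intro h
    by_contra hd
    have := h i j hd
    rw [hentry, one_apply_ne hij, single_apply_same, zero_add] at this
    exact hc this
  · intro h a b hab
    rw [hentry, one_apply_ne fun hab' => hab (congrArg d hab'), zero_add, single_apply, if_neg]
    rintro ⟨rfl, rfl⟩
    exact hab h

variable [NeZero n]

theorem transvection_mem_leviGroup_of_mem {J : Finset (Fin n)} {a : Fin n} (ha : a ∈ J)
    {i j : Fin n} (hij : i ≠ j) (h : i = a ∧ j = a + 1 ∨ i = a + 1 ∧ j = a) (c : k) :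
    SpecialLinearGroup.transvection hij c ∈ leviGroup k J := by
  refine Subgroup.subset_closure (Or.inr (Set.mem_iUnion₂.mpr
    ⟨extSimpleRoot n a, ⟨a, ha, rfl⟩, ?_⟩))
  rw [extSimpleRoot_eq]
  rcases h with ⟨rfl, rfl⟩ | ⟨rfl, rfl⟩
  · exact Or.inl ⟨_, _, hij, rfl, c, rfl⟩
  · exact Or.inr ⟨_, _, hij, neg_sub _ _, c, rfl⟩

/-- The root groups of `±α`, `α ∈ J`, consist of transvections along the edges of `J`. -/
theorem exists_transvection_of_mem_rootGroup {a : Fin n}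
    {g : SpecialLinearGroup (Fin n) k}
    (h : g ∈ rootGroup k (extSimpleRoot n a) ∪ rootGroup k (-extSimpleRoot n a)) :
    ∃ (i j : Fin n) (hij : i ≠ j) (c : k), (i = a ∧ j = a + 1 ∨ i = a + 1 ∧ j = a) ∧
      g = SpecialLinearGroup.transvection hij c := by
  rw [extSimpleRoot_eq] at h
  rcases h with ⟨i, j, hij, h, c, hc⟩ | ⟨i, j, hij, h, c, hc⟩
  · obtain ⟨h1, h2⟩ := stdVec_sub_inj hij h.symm
    exact ⟨i, j, hij, c, Or.inl ⟨h1, h2⟩, Subtype.ext hc⟩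
  · rw [neg_sub] at h
    obtain ⟨h1, h2⟩ := stdVec_sub_inj hij h.symm
    exact ⟨i, j, hij, c, Or.inr ⟨h1, h2⟩, Subtype.ext hc⟩

theorem leviGroup_le_centralizer {J : Finset (Fin n)} {d : Fin n → k}
    (hd : ∀ i j, Linked J i j → d i = d j) : leviGroup k J ≤ centralizer (diagonal d) := by
  rw [leviGroup, Subgroup.closure_le]
  rintro g (hg | hg)
  · rw [SetLike.mem_coe, mem_centralizer_diagonal_iff]
    exact fun i j hij => hg fun h => hij (congrArg d h)
  · obtain ⟨_, ⟨a, ha, rfl⟩, hg⟩ := Set.mem_iUnion₂.mp hg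
    obtain ⟨i, j, hij, c, h, rfl⟩ := exists_transvection_of_mem_rootGroup hg
    have hda : d a = d (a + 1) := hd _ _ (Relation.EqvGen.rel _ _ ⟨ha, rfl⟩)
    rw [SetLike.mem_coe, mem_centralizer_diagonal_iff]
    intro l m hlm
    change (1 : Matrix (Fin n) (Fin n) k) l m + single i j c l m = 0
    rw [one_apply_ne fun h => hlm (congrArg d h), zero_add, single_apply, if_neg]
    rintro ⟨rfl, rfl⟩
    rcases h with ⟨rfl, rfl⟩ | ⟨rfl, rfl⟩
    · exact hlm hda
    · exact hlm hda.symm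

omit [NeZero n] in
/-- The commutator relation `[1 + c E_{ij}, 1 + E_{jl}] = 1 + c E_{il}`. -/
theorem transvection_commutator {i j l : Fin n} (hij : i ≠ j) (hjl : j ≠ l) (hil : i ≠ l) (c : k) :
    SpecialLinearGroup.transvection hil c =
      (SpecialLinearGroup.transvection hij c * SpecialLinearGroup.transvection hjl 1) *
        (SpecialLinearGroup.transvection hjl 1 * SpecialLinearGroup.transvection hij c)⁻¹ := by
  rw [eq_mul_inv_iff_mul_eq]
  apply Subtype.ext
  change (1 + single i l c) * ((1 + single j l 1) * (1 + single i j c)) =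
    (1 + single i j c) * (1 + single j l (1 : k))
  simp only [Matrix.mul_add, Matrix.add_mul, single_mul_single_same, mul_one, one_mul,
    single_mul_single_of_ne _ _ _ _ hil.symm, add_zero, single_mul_single_of_ne _ _ _ _ hjl.symm]
  abel

/-- The root groups for all pairs of indices in one block of `J` lie in the Levi subgroup. -/
theorem transvection_mem_leviGroup {J : Finset (Fin n)} {i j : Fin n}
    (h : Linked J i j) (hij : i ≠ j) (c : k) :
    SpecialLinearGroup.transvection hij c ∈ leviGroup k J := by
  suffices H : ∀ {i j : Fin n}, Linked J i j →
      (∀ (hij : i ≠ j) (c : k), SpecialLinearGroup.transvection hij c ∈ leviGroup k J) ∧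
      ∀ (hji : j ≠ i) (c : k), SpecialLinearGroup.transvection hji c ∈ leviGroup k J from
    (H h).1 hij c
  intro i j h
  induction h with
  | rel x y hxy =>
    exact ⟨fun h => transvection_mem_leviGroup_of_mem hxy.1 h (Or.inl ⟨rfl, hxy.2⟩),
      fun h => transvection_mem_leviGroup_of_mem hxy.1 h (Or.inr ⟨hxy.2, rfl⟩)⟩
  | refl x => exact ⟨fun h => absurd rfl h, fun h => absurd rfl h⟩
  | symm x y _ ih => exact ih.symm
  | trans x y z _ _ ih1 ih2 =>
    by_cases hxy : x = y
    · subst hxy; exact ih2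
    by_cases hyz : y = z
    · subst hyz; exact ih1
    have key : ∀ {a b e : Fin n} (hab : a ≠ b) (hbe : b ≠ e) (hae : a ≠ e) (c : k),
        (∀ c : k, SpecialLinearGroup.transvection hab c ∈ leviGroup k J) →
        (∀ c : k, SpecialLinearGroup.transvection hbe c ∈ leviGroup k J) →
        SpecialLinearGroup.transvection hae c ∈ leviGroup k J := by
      intro a b e hab hbe hae c h1 h2
      rw [transvection_commutator hab hbe hae c]
      exact mul_mem (mul_mem (h1 _) (h2 _)) (inv_mem (mul_mem (h2 _) (h1 _)))
    exact ⟨fun h c => key hxy hyz h c (ih1.1 hxy) (ih2.1 hyz),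
      fun h c => key (Ne.symm hyz) (Ne.symm hxy) h c (ih2.2 _) (ih1.2 _)⟩

/-- The Levi subgroup is normalized by all invertible diagonal matrices. -/
theorem exists_diagonal_mul_eq {J : Finset (Fin n)} {D : Fin n → k}
    (hD : ∀ i, D i ≠ 0) {u : SpecialLinearGroup (Fin n) k} (hu : u ∈ leviGroup k J) :
    ∃ v ∈ leviGroup k J, diagonal D * (u : Matrix (Fin n) (Fin n) k) = v * diagonal D := by
  unfold leviGroup at hu
  induction hu using Subgroup.closure_induction with
  | mem x hx =>
    rcases hx with hx | hx
    · refine ⟨x, Subgroup.subset_closure (Or.inl hx), ?_⟩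
      have hx' : (x : Matrix (Fin n) (Fin n) k).IsDiag := hx
      rw [← hx'.diagonal_diag, diagonal_mul_diagonal, diagonal_mul_diagonal]
      simp only [mul_comm]
    · obtain ⟨_, ⟨a, ha, rfl⟩, hg⟩ := Set.mem_iUnion₂.mp hx
      obtain ⟨i, j, hij, c, h, rfl⟩ := exists_transvection_of_mem_rootGroup hg
      refine ⟨SpecialLinearGroup.transvection hij (D i * c * (D j)⁻¹),
        transvection_mem_leviGroup_of_mem ha hij h _, ?_⟩
      rw [SpecialLinearGroup.transvection_coe, SpecialLinearGroup.transvection_coe, Matrix.mul_add,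
        Matrix.add_mul, Matrix.mul_one, Matrix.one_mul]
      congr 1
      ext l m
      rw [diagonal_mul, mul_diagonal, single_apply, single_apply]
      split_ifs with hlm
      · obtain ⟨rfl, rfl⟩ := hlm
        rw [mul_assoc, inv_mul_cancel₀ (hD _), mul_one]
      · simp
  | one => exact ⟨1, one_mem _, by simp⟩
  | mul x y _ _ hx hy =>
    obtain ⟨v, hv, hxv⟩ := hx
    obtain ⟨w, hw, hyw⟩ := hy
    refine ⟨v * w, mul_mem hv hw, ?_⟩
    change diagonal D * ((x : Matrix (Fin n) (Fin n) k) * y) =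
      (v : Matrix (Fin n) (Fin n) k) * w * diagonal D
    rw [← Matrix.mul_assoc, hxv, Matrix.mul_assoc, hyw, Matrix.mul_assoc]
  | inv x _ hx =>
    obtain ⟨v, hv, hxv⟩ := hx
    refine ⟨v⁻¹, inv_mem hv, ?_⟩
    calc diagonal D * ((x⁻¹ : SpecialLinearGroup (Fin n) k) : Matrix (Fin n) (Fin n) k)
        = (((v⁻¹ : SpecialLinearGroup (Fin n) k) : Matrix (Fin n) (Fin n) k) * v) * diagonal D *
            ((x⁻¹ : SpecialLinearGroup (Fin n) k) : Matrix (Fin n) (Fin n) k) := by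
          rw [coe_inv_mul_coe, Matrix.one_mul]
      _ = ((v⁻¹ : SpecialLinearGroup (Fin n) k) : Matrix (Fin n) (Fin n) k) * (diagonal D * x) *
            ((x⁻¹ : SpecialLinearGroup (Fin n) k) : Matrix (Fin n) (Fin n) k) := by
          rw [hxv]; simp only [Matrix.mul_assoc]
      _ = ((v⁻¹ : SpecialLinearGroup (Fin n) k) : Matrix (Fin n) (Fin n) k) * diagonal D *
            (x * ((x⁻¹ : SpecialLinearGroup (Fin n) k) : Matrix (Fin n) (Fin n) k)) := by
          simp only [Matrix.mul_assoc]
      _ = _ := by rw [coe_mul_coe_inv, Matrix.mul_one]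

/-- The monoid of all products `u D` of an element `u` of the Levi subgroup of `J` and an
invertible diagonal matrix `D`; this is the Levi subgroup of `GL_n`. -/
def leviMonoid (k : Type*) [Field k] (J : Finset (Fin n)) :
    Submonoid (Matrix (Fin n) (Fin n) k) where
  carrier := {M | ∃ u ∈ leviGroup k J, ∃ D : Fin n → k, (∀ i, D i ≠ 0) ∧
    M = (u : Matrix (Fin n) (Fin n) k) * diagonal D}
  one_mem' := ⟨1, one_mem _, 1, fun _ => one_ne_zero, by
    change (1 : Matrix (Fin n) (Fin n) k) = 1 * diagonal 1
    rw [Matrix.one_mul]; exact diagonal_one.symm⟩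
  mul_mem' := by
    rintro _ _ ⟨u, hu, D, hD, rfl⟩ ⟨v, hv, E, hE, rfl⟩
    obtain ⟨w, hw, h⟩ := exists_diagonal_mul_eq hD hv
    refine ⟨u * w, mul_mem hu hw, fun i => D i * E i, fun i => mul_ne_zero (hD i) (hE i), ?_⟩
    change (u : Matrix (Fin n) (Fin n) k) * diagonal D * (v * diagonal E) =
      (u : Matrix (Fin n) (Fin n) k) * w * diagonal fun i => D i * E i
    rw [← diagonal_mul_diagonal, Matrix.mul_assoc, Matrix.mul_assoc,
      ← Matrix.mul_assoc (diagonal D), h, Matrix.mul_assoc]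

/-- A matrix that vanishes outside the fibres of a labelling `b`, assembled from its blocks. -/
def assemble {ι : Type*} [Fintype ι] [DecidableEq ι] (b : Fin n → ι) :
    (∀ t, Matrix {i // b i = t} {i // b i = t} k) →* Matrix (Fin n) (Fin n) k :=
  ((Matrix.reindexAlgEquiv k k (Equiv.sigmaFiberEquiv b)).toRingEquiv.toMonoidHom).comp
    (Matrix.blockDiagonal'RingHom (fun t => {i // b i = t}) k).toMonoidHom

omit [NeZero n] in
theorem assemble_apply {ι : Type*} [Fintype ι] [DecidableEq ι] (b : Fin n → ι)
    (M : ∀ t, Matrix {i // b i = t} {i // b i = t} k) (i j : Fin n) :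
    assemble b M i j = if h : b i = b j then M (b j) ⟨i, h⟩ ⟨j, rfl⟩ else 0 := by
  have key : ∀ (t s : ι) (x : {l // b l = t}) (y : {l // b l = s}), blockDiagonal' M ⟨t, x⟩ ⟨s, y⟩ =
      if h : t = s then M s ⟨x.1, x.2.trans h⟩ y else 0 := by
    intro t s x y
    by_cases h : t = s
    · subst h
      rw [blockDiagonal'_apply_eq, dif_pos rfl]
    · rw [blockDiagonal'_apply_ne _ _ _ h, dif_neg h]
  exact key (b i) (b j) ⟨i, rfl⟩ ⟨j, rfl⟩

theorem assemble_mulSingle_mem {J : Finset (Fin n)} {ι : Type*} [Fintype ι]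
    [DecidableEq ι] (b : Fin n → ι) (hb : ∀ i j, b i = b j → Linked J i j) (t : ι)
    (M : Matrix {i // b i = t} {i // b i = t} k) (hM : M.det ≠ 0) :
    assemble b (Pi.mulSingle t M) ∈ leviMonoid k J := by
  refine diagonal_transvection_induction_of_det_ne_zero
    (fun M => assemble b (Pi.mulSingle t M) ∈ leviMonoid k J) M hM ?_ ?_ ?_
  · intro D hD
    have hD' : ∀ i, D i ≠ 0 := by
      rw [det_diagonal, Finset.prod_ne_zero_iff] at hD
      exact fun i => hD i (Finset.mem_univ _)
    refine ⟨1, one_mem _, fun i => if h : b i = t then D ⟨i, h⟩ else 1, fun i => ?_, ?_⟩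
    · dsimp only
      split_ifs
      · exact hD' _
      · exact one_ne_zero
    · refine Eq.trans ?_ (Matrix.one_mul _).symm
      ext i j
      rw [assemble_apply]
      by_cases hij : i = j
      · subst hij
        rw [dif_pos rfl, diagonal_apply_eq]
        by_cases hi : b i = t
        · subst hi
          rw [dif_pos rfl, Pi.mulSingle_eq_same, diagonal_apply_eq]
        · rw [dif_neg hi, Pi.mulSingle_eq_of_ne hi, Matrix.one_apply_eq]
      · rw [diagonal_apply_ne _ hij]
        split_ifs with h
        · by_cases hj : b j = t
          · subst hj
            rw [Pi.mulSingle_eq_same, diagonal_apply_ne]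
            exact fun h => hij (congrArg Subtype.val h)
          · rw [Pi.mulSingle_eq_of_ne hj, Matrix.one_apply_ne]
            exact fun h => hij (congrArg Subtype.val h)
        · rfl
  · intro s
    obtain ⟨⟨i, hi⟩, ⟨j, hj⟩, hij, c⟩ := s
    have hij' : i ≠ j := fun h => hij (Subtype.ext h)
    refine ⟨_, transvection_mem_leviGroup (hb i j (hi.trans hj.symm)) hij' c, 1,
      fun _ => one_ne_zero, ?_⟩
    rw [show diagonal (1 : Fin n → k) = 1 from diagonal_one, Matrix.mul_one]
    ext l m
    rw [assemble_apply, SpecialLinearGroup.transvection_coe, Matrix.add_apply, single_apply]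
    by_cases hlm : b l = b m
    · rw [dif_pos hlm]
      by_cases hm : b m = t
      · subst hm
        rw [Pi.mulSingle_eq_same, TransvectionStruct.toMatrix_mk, transvection, Matrix.add_apply,
          single_apply, Matrix.one_apply, Matrix.one_apply]
        simp only [Subtype.mk.injEq]
      · have hjm : ¬(i = l ∧ j = m) := by
          rintro ⟨-, rfl⟩
          exact hm hj
        rw [Pi.mulSingle_eq_of_ne hm, if_neg hjm, add_zero, Matrix.one_apply,
          Matrix.one_apply]
        simp only [Subtype.mk.injEq]
    · rw [dif_neg hlm, Matrix.one_apply_ne fun h => hlm (congrArg b h), if_neg, add_zero]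
      rintro ⟨rfl, rfl⟩
      exact hlm (hi.trans hj.symm)
  · intro A B _ _ hA hB
    rw [Pi.mulSingle_mul, map_mul]
    exact mul_mem hA hB

/-- The centralizer of a diagonal matrix that separates exactly the blocks of `J` is the Levi
subgroup of `J`. -/
theorem centralizer_diagonal_eq {J : Finset (Fin n)} {d : Fin n → k}
    (hd : ∀ i j, Linked J i j ↔ d i = d j) : centralizer (diagonal d) = leviGroup k J := by
  classical
  refine le_antisymm (fun g hg => ?_) (leviGroup_le_centralizer fun i j => (hd i j).mp)
  let b : Fin n → Finset.univ.image d := fun i =>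
    ⟨d i, Finset.mem_image_of_mem _ (Finset.mem_univ _)⟩
  have hb : ∀ i j, b i = b j ↔ d i = d j := fun i j =>
    ⟨fun h => congrArg Subtype.val h, fun h => Subtype.ext h⟩
  let B : SpecialLinearGroup (Fin n) k → ∀ t, Matrix {i // b i = t} {i // b i = t} k :=
    fun g t i j => (g : Matrix (Fin n) (Fin n) k) i.1 j.1
  have hB : ∀ g ∈ centralizer (diagonal d), assemble b (B g) = g := by
    intro g hg
    rw [mem_centralizer_diagonal_iff] at hg
    ext i j
    rw [assemble_apply]
    split_ifs with h
    · rfl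
    · exact (hg i j fun h' => h ((hb i j).mpr h')).symm
  have hinj : Function.Injective (assemble b : _ →* Matrix (Fin n) (Fin n) k) :=
    (Matrix.reindexAlgEquiv k k (Equiv.sigmaFiberEquiv b)).injective.comp blockDiagonal'_injective
  have hBB : B g * B g⁻¹ = 1 := by
    apply hinj
    rw [map_mul, hB g hg, hB _ (inv_mem hg), map_one, coe_mul_coe_inv]
  have hdet : ∀ t, (B g t).det ≠ 0 := fun t h => by
    have := congrArg Matrix.det (congrFun hBB t)
    rw [Pi.mul_apply, det_mul, h, zero_mul, Pi.one_apply, det_one] at this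
    exact zero_ne_one this
  have hmem : B g ∈ (leviMonoid k J).comap (assemble b) :=
    Submonoid.pi_mem_of_mulSingle_mem _ fun t =>
      assemble_mulSingle_mem b (fun i j h => (hd i j).mpr ((hb i j).mp h)) t _ (hdet t)
  rw [Submonoid.mem_comap, hB g hg] at hmem
  obtain ⟨u, hu, D, -, h⟩ := hmem
  have hdetD : (diagonal D).det = 1 := by
    have := congrArg Matrix.det h
    rwa [det_mul, g.2, u.2, one_mul, eq_comm] at this
  have : g = u * ⟨diagonal D, hdetD⟩ := Subtype.ext h
  rw [this]
  exact mul_mem hu (Subgroup.subset_closure (Or.inl (isDiag_diagonal D)))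

/-- If the centralizer of `y` is the Levi subgroup of `J`, then `y` is diagonal and its entries
separate exactly the blocks of `J`. -/
theorem exists_diagonal_of_centralizer_eq [Infinite k] {J : Finset (Fin n)}
    {y : Matrix (Fin n) (Fin n) k} (hy : centralizer y = leviGroup k J) :
    ∃ d, y = diagonal d ∧ ∀ i j, Linked J i j ↔ d i = d j := by
  classical
  -- an element of the torus whose entries at two given indices differ
  obtain ⟨s, hs⟩ := Infinite.exists_notMem_finset ({0, 1, -1} : Finset k)
  simp only [Finset.mem_insert, Finset.mem_singleton, not_or] at hs
  obtain ⟨hs0, hs1, hs2⟩ := hs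
  have hdiag : y = diagonal fun i => y i i := by
    ext i j
    by_cases hij : i = j
    · rw [hij, diagonal_apply_eq]
    rw [diagonal_apply_ne _ hij]
    have hmem : SpecialLinearGroup.diag2n hij s hs0 ∈ centralizer y := by
      rw [hy]
      exact Subgroup.subset_closure (Or.inl (isDiag_diagonal _))
    rw [mem_centralizer_iff, SpecialLinearGroup.diag2n_coe] at hmem
    have := congrFun (congrFun hmem i) j
    rw [diagonal_mul, mul_diagonal, if_pos rfl, if_neg (Ne.symm hij), if_pos rfl] at this
    have h2 : (s - s⁻¹) * y i j = 0 := by rw [sub_mul, this]; ring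
    refine (mul_eq_zero.mp h2).resolve_left fun h => ?_
    have h3 : (s - 1) * (s + 1) = 0 := by
      have h4 : s * s⁻¹ = 1 := mul_inv_cancel₀ hs0
      rw [← sub_eq_zero.mp h] at h4
      linear_combination h4
    rcases mul_eq_zero.mp h3 with h | h
    · exact hs1 (sub_eq_zero.mp h)
    · exact hs2 (eq_neg_of_add_eq_zero_left h)
  refine ⟨_, hdiag, fun i j => ?_⟩
  by_cases hij : i = j
  · subst hij
    exact iff_of_true (Relation.EqvGen.refl _) rfl
  rw [← transvection_mem_centralizer_diagonal_iff hij (one_ne_zero (α := k)) (fun i => y i i),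
    ← hdiag, hy]
  refine ⟨fun h => transvection_mem_leviGroup h hij 1, fun h => ?_⟩
  -- compare with the indicator function of the block of `i`
  have h1 := leviGroup_le_centralizer (d := fun l => if Linked J i l then (1 : k) else 0)
    (fun l m hlm => by
      have : Linked J i l ↔ Linked J i m :=
        ⟨fun h => h.trans _ _ _ hlm, fun h => h.trans _ _ _ hlm.symm⟩
      simp only [this]) h
  rw [transvection_mem_centralizer_diagonal_iff hij one_ne_zero,
    if_pos (show Linked J i i from Relation.EqvGen.refl _)] at h1
  by_contra hne
  rw [if_neg hne] at h1
  exact one_ne_zero h1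

omit [NeZero n] in
theorem centralizer_adj (g : SpecialLinearGroup (Fin n) k) (x : Matrix (Fin n) (Fin n) k) :
    centralizer (adj g x) = (centralizer x).map (MulAut.conj g).toMonoidHom := by
  ext h
  rw [Subgroup.mem_map_equiv, MulAut.conj_symm_apply]
  change adj h (adj g x) = adj g x ↔ adj (g⁻¹ * h * g) x = x
  rw [mul_assoc, adj_mul, adj_mul]
  constructor
  · intro e
    rw [e, ← adj_mul, inv_mul_cancel, adj_one]
  · intro e
    have := congrArg (adj g) e
    rwa [← adj_mul, mul_inv_cancel, adj_one] at this

end Centralizer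

open Polynomial

/-! ### Split semisimple elements are the conjugates of diagonal matrices over `𝔽_q` -/

section SplitElements

variable {n : ℕ} {k : Type*} [Field k] {p : ℕ} [Fact p.Prime] [CharP k p] {a : ℕ}

theorem mem_groupFixed_iff (g : SpecialLinearGroup (Fin n) k) :
    g ∈ groupFixed n p a k ↔
      (g : Matrix (Fin n) (Fin n) k).map (iterateFrobenius k p a) = g := Subtype.ext_iff

theorem adj_mem_lieFixed {g : SpecialLinearGroup (Fin n) k} (hg : g ∈ groupFixed n p a k)
    {x : Matrix (Fin n) (Fin n) k} (hx : x ∈ lieFixed n p a k) : adj g x ∈ lieFixed n p a k := by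
  have hg' := inv_mem hg
  rw [mem_groupFixed_iff] at hg hg'
  obtain ⟨h1, h2⟩ := hx
  constructor
  · change trace (adj g x) = 0
    rw [adj, trace_mul_cycle, coe_inv_mul_coe, Matrix.one_mul]
    exact h1
  · rw [adj, Matrix.map_mul, Matrix.map_mul, hg, hg', h2]

theorem charpoly_adj (g : SpecialLinearGroup (Fin n) k) (x : Matrix (Fin n) (Fin n) k) :
    (adj g x).charpoly = x.charpoly := by
  rw [adj, charpoly_mul_comm, ← Matrix.mul_assoc, coe_inv_mul_coe, Matrix.one_mul]

theorem orbit_adj {g : SpecialLinearGroup (Fin n) k} (hg : g ∈ groupFixed n p a k)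
    (x : Matrix (Fin n) (Fin n) k) : orbit p a (adj g x) = orbit p a x := by
  ext y
  constructor
  · rintro ⟨h, hh, rfl⟩
    exact ⟨h * g, mul_mem hh hg, (adj_mul h g x).symm⟩
  · rintro ⟨h, hh, rfl⟩
    refine ⟨h * g⁻¹, mul_mem hh (inv_mem hg), ?_⟩
    rw [← adj_mul, inv_mul_cancel_right]

theorem mem_orbit_self (x : Matrix (Fin n) (Fin n) k) : x ∈ orbit p a x :=
  ⟨1, one_mem _, (adj_one x).symm⟩

/-- The subfield `𝔽_q` of `k`, `q = p ^ a`. -/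
def fixedField (k : Type*) [Field k] (p : ℕ) [Fact p.Prime] [CharP k p] (a : ℕ) : Subfield k :=
  (iterateFrobenius k p a).eqLocusField (RingHom.id k)

theorem mem_fixedField_iff (x : k) : x ∈ fixedField k p a ↔ iterateFrobenius k p a x = x := Iff.rfl

theorem diagonal_mem_lieFixed_iff (d : Fin n → k) :
    diagonal d ∈ lieFixed n p a k ↔ ∑ i, d i = 0 ∧ ∀ i, d i ∈ fixedField k p a := by
  refine and_congr ?_ ?_
  · change trace (diagonal d) = 0 ↔ _
    rw [trace_diagonal]
  · rw [diagonal_map (map_zero _), diagonal_injective.eq_iff, funext_iff]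
    rfl

variable (p a) in
theorem card_fixedField [IsAlgClosed k] (ha : 1 ≤ a) : Nat.card (fixedField k p a) = p ^ a := by
  classical
  have hp := (Fact.out : p.Prime).one_lt
  have h := card_rootSet_eq_natDegree (F := k) (K := k)
    (galois_poly_separable p (p ^ a) (dvd_pow_self p (by omega))) (IsAlgClosed.splits _)
  rw [FiniteField.X_pow_card_pow_sub_X_natDegree_eq k (by omega) hp,
    ← Nat.card_eq_fintype_card] at h
  rw [← h]
  refine Nat.card_congr (Equiv.subtypeEquivRight fun x => ?_)
  rw [mem_rootSet_of_ne (FiniteField.X_pow_card_pow_sub_X_ne_zero k (by omega) hp),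
    mem_fixedField_iff, iterateFrobenius_def]
  simp [sub_eq_zero]

theorem isSemisimple_adj_diagonal (ha : 1 ≤ a) (g : SpecialLinearGroup (Fin n) k) {d : Fin n → k}
    (hd : ∀ i, d i ∈ fixedField k p a) : Module.End.IsSemisimple (toLin' (adj g (diagonal d))) := by
  have hpow : adj g (diagonal d) ^ p ^ a = adj g (diagonal d) := by
    have h1 : SemiconjBy (g : Matrix (Fin n) (Fin n) k) (diagonal d) (adj g (diagonal d)) :=
      (adj_eq_iff g _ _).mp rfl
    have h2 := h1.pow_right (p ^ a)
    rw [diagonal_pow, show d ^ p ^ a = d from funext fun i => by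
      have := hd i
      rwa [mem_fixedField_iff, iterateFrobenius_def] at this] at h2
    exact ((adj_eq_iff g _ _).mpr h2).symm
  refine Module.End.isSemisimple_of_squarefree_aeval_eq_zero (p := X ^ p ^ a - X)
    (galois_poly_separable p (p ^ a) (dvd_pow_self p (by omega))).squarefree ?_
  change aeval (toLinAlgEquiv' (adj g (diagonal d))) _ = 0
  rw [map_sub, map_pow, aeval_X, ← map_pow, hpow, sub_self]

/-- Permuting the entries of a diagonal matrix is effected by a monomial matrix in `SL(n, q)`. -/
theorem exists_adj_diagonal_comp [NeZero n] (d : Fin n → k) (σ : Equiv.Perm (Fin n)) :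
    ∃ g ∈ groupFixed n p a k, adj g (diagonal d) = diagonal (d ∘ σ) := by
  -- the sign at one place corrects the determinant of the permutation matrix
  let s : Fin n → k := fun i => if i = 0 then ((Equiv.Perm.sign σ : ℤ) : k) else 1
  have hdet : (σ.permMatrix k * diagonal s).det = 1 := by
    rw [det_mul, det_permutation, det_diagonal, Finset.prod_ite_eq' Finset.univ (0 : Fin n),
      if_pos (Finset.mem_univ _), ← Int.cast_mul, ← Units.val_mul, Int.units_mul_self]
    simp
  have hentry : ∀ i j, σ.permMatrix k i j = if σ i = j then 1 else 0 := fun i j => by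
    simp [PEquiv.toMatrix_apply, Equiv.toPEquiv_apply, eq_comm]
  obtain ⟨g, hg⟩ : ∃ g : SpecialLinearGroup (Fin n) k,
      (g : Matrix (Fin n) (Fin n) k) = σ.permMatrix k * diagonal s := ⟨⟨_, hdet⟩, rfl⟩
  refine ⟨g, ?_, ?_⟩
  · rw [mem_groupFixed_iff, hg]
    ext i j
    change iterateFrobenius k p a ((σ.permMatrix k * diagonal s) i j) =
      (σ.permMatrix k * diagonal s) i j
    rw [mul_diagonal, hentry, map_mul]
    congr 1
    · split_ifs <;> simp
    · dsimp only [s]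
      split_ifs
      · exact map_intCast _ _
      · exact map_one _
  · rw [adj_eq_iff, hg]
    ext i j
    rw [mul_diagonal, mul_diagonal, diagonal_mul, mul_diagonal, hentry]
    split_ifs with h
    · rw [← h, Function.comp_apply]; ring
    · ring

open Classical in
theorem rootMultiplicity_charpoly_diagonal (d : Fin n → k) (b : k) :
    (diagonal d).charpoly.rootMultiplicity b = (Finset.univ.filter fun i => d i = b).card := by
  have h : (diagonal d).charpoly = ((Finset.univ.val.map d).map fun x => X - C x).prod := by
    rw [charpoly_diagonal, Multiset.map_map]
    rfl
  rw [← count_roots, h, roots_multiset_prod_X_sub_C, Multiset.count_map]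
  simp only [eq_comm, Finset.card_def, Finset.filter_val]

/-- Diagonal matrices are in the same `SL(n, q)`-orbit if and only if their entries agree up to
order: the characteristic polynomial recovers the entries. -/
theorem orbit_diagonal_eq_iff [NeZero n] (d e : Fin n → k) :
    orbit p a (diagonal d) = orbit p a (diagonal e) ↔ ∃ σ : Equiv.Perm (Fin n), e ∘ σ = d := by
  classical
  constructor
  · intro h
    obtain ⟨g, -, hg⟩ : diagonal d ∈ orbit p a (diagonal e) := h ▸ mem_orbit_self _
    have hc := charpoly_adj g (diagonal e)
    rw [← hg] at hc
    obtain ⟨σ, hσ⟩ := exists_equiv_of_map_eq d e (by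
      ext b
      have := congrArg (rootMultiplicity b) hc
      rw [rootMultiplicity_charpoly_diagonal, rootMultiplicity_charpoly_diagonal] at this
      rw [Multiset.count_map, Multiset.count_map]
      simpa only [eq_comm, Finset.card_def, Finset.filter_val] using this)
    exact ⟨σ, funext hσ⟩
  · rintro ⟨σ, rfl⟩
    obtain ⟨g, hg, h⟩ := exists_adj_diagonal_comp (p := p) (a := a) e σ
    rw [← h, orbit_adj hg]

variable [NeZero n] [IsAlgClosed k]

/-- The elements of genus `(J, [id])` are the `SL(n, q)`-conjugates of the diagonal matrices in
`sl(n, q)` whose entries separate exactly the blocks of `J`. -/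
theorem inGenus_iff (ha : 1 ≤ a) (J : Finset (Fin n)) (x : Matrix (Fin n) (Fin n) k) :
    InGenus p a J x ↔ ∃ d : Fin n → k, (∀ i, d i ∈ fixedField k p a) ∧ ∑ i, d i = 0 ∧
      (∀ i j, Linked J i j ↔ d i = d j) ∧ ∃ g ∈ groupFixed n p a k, x = adj g (diagonal d) := by
  constructor
  · rintro ⟨⟨hx, -⟩, g, hg, hc⟩
    have hxy : x = adj g (adj g⁻¹ x) := by rw [← adj_mul, mul_inv_cancel, adj_one]
    have hy : centralizer (adj g⁻¹ x) = leviGroup k J := by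
      apply Subgroup.map_injective (f := (MulAut.conj g).toMonoidHom) (MulAut.conj g).injective
      refine Eq.trans ?_ hc
      conv_rhs => rw [hxy]
      exact (centralizer_adj g _).symm
    have : Infinite k := IsAlgClosed.instInfinite
    obtain ⟨d, hd, hJ⟩ := exists_diagonal_of_centralizer_eq hy
    have hmem := adj_mem_lieFixed (inv_mem hg) hx
    rw [hd, diagonal_mem_lieFixed_iff] at hmem
    exact ⟨d, hmem.2, hmem.1, hJ, g, hg, hd ▸ hxy⟩
  · rintro ⟨d, hd, hsum, hJ, g, hg, rfl⟩
    refine ⟨⟨adj_mem_lieFixed hg ((diagonal_mem_lieFixed_iff d).mpr ⟨hsum, hd⟩),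
      isSemisimple_adj_diagonal ha g hd⟩, g, hg, ?_⟩
    rw [centralizer_adj, centralizer_diagonal_eq hJ]

omit [IsAlgClosed k] [Fact p.Prime] [CharP k p] in
/-- If `d` separates exactly the blocks of `J`, the blocks of size `i ≥ 1` correspond to the roots
of multiplicity `i` of the characteristic polynomial. For `i = 0` the left side counts non-roots. -/
theorem ncard_rootMultiplicity_eq {J : Finset (Fin n)} {d : Fin n → k}
    (hd : ∀ i j, Linked J i j ↔ d i = d j) {i : ℕ} (hi : 1 ≤ i) :
    {b : k | (diagonal d).charpoly.rootMultiplicity b = i}.ncard = (blockSizes J).count i := by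
  classical
  let b : Fin n → Finset.univ.image d := fun i =>
    ⟨d i, Finset.mem_image_of_mem _ (Finset.mem_univ _)⟩
  have hb : ∀ i j, Linked J i j ↔ b i = b j := fun i j => (hd i j).trans
    ⟨fun h => Subtype.ext h, fun h => congrArg Subtype.val h⟩
  have hsurj : Function.Surjective b := by
    rintro ⟨y, hy⟩
    obtain ⟨j, -, rfl⟩ := Finset.mem_image.mp hy
    exact ⟨j, rfl⟩
  have hbd : ∀ t : Finset.univ.image d,
      (Finset.univ.filter fun j => b j = t) = Finset.univ.filter fun j => d j = t.1 := fun t =>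
    Finset.filter_congr fun j _ => Subtype.ext_iff
  rw [blockSizes_eq_map hsurj hb, Multiset.count_map]
  simp only [rootMultiplicity_charpoly_diagonal, hbd]
  have hset : {y : k | (Finset.univ.filter fun j => d j = y).card = i} =
      ((Finset.univ.filter fun t : Finset.univ.image d =>
        i = (Finset.univ.filter fun j => d j = t.1).card).map
          (Function.Embedding.subtype _) : Finset k) := by
    ext y
    simp only [Set.mem_ofPred_eq, Finset.coe_map, Function.Embedding.subtype_apply, Set.mem_image,
      Finset.mem_coe, Finset.mem_filter, Finset.mem_univ, true_and]
    constructor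
    · intro h
      obtain ⟨j, hj⟩ := Finset.card_pos.mp (show 0 < _ by rw [h]; exact hi)
      have hj : d j = y := by simpa using hj
      exact ⟨b j, by rw [← h, ← hj], hj⟩
    · rintro ⟨t, ht, rfl⟩
      exact ht.symm
  rw [hset, Set.ncard_coe_finset, Finset.card_map]
  rfl

theorem genusOrbits_eq_splitOrbits (ha : 1 ≤ a) {J : Finset (Fin n)}
    (hJ : J ≠ Finset.univ) {lam : n.Partition} (h : blockSizes J = lam.parts) :
    genusOrbits p a k J = splitOrbits p a k lam := by
  ext O
  constructor
  · rintro ⟨x, hx, rfl⟩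
    refine ⟨x, ⟨J, hJ, hx⟩, fun i hi => ?_, rfl⟩
    obtain ⟨d, -, -, hd, g, -, rfl⟩ := (inGenus_iff ha J x).mp hx
    rw [charpoly_adj, ncard_rootMultiplicity_eq hd hi, h]
  · rintro ⟨x, ⟨S, hS, hx⟩, hcount, rfl⟩
    obtain ⟨d, hdq, hsum, hd, g, hg, rfl⟩ := (inGenus_iff ha S x).mp hx
    have hsizes : blockSizes S = blockSizes J := by
      rw [h]
      ext i
      rcases Nat.eq_zero_or_pos i with rfl | hi
      · obtain ⟨mu, hmu⟩ := exists_partition_eq_blockSizes hS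
        have h0 : ∀ nu : n.Partition, nu.parts.count 0 = 0 := fun nu =>
          Multiset.count_eq_zero.mpr fun h => lt_irrefl 0 (nu.parts_pos h)
        rw [hmu, h0, h0]
      · rw [← ncard_rootMultiplicity_eq hd hi, ← hcount i hi, charpoly_adj]
    obtain ⟨σ, hσ⟩ := exists_isLinkIso_of_blockSizes_eq hS hJ hsizes
    refine ⟨_, (inGenus_iff ha J _).mpr ⟨d ∘ ⇑σ⁻¹, fun i => hdq _, ?_, fun i j => ?_, 1,
      one_mem _, rfl⟩, ?_⟩
    · rw [← hsum]
      exact Equiv.sum_comp σ⁻¹ d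
    · rw [← hσ.inv.linked, hd]
      rfl
    · rw [orbit_adj hg, orbit_adj (one_mem _), orbit_diagonal_eq_iff]
      exact ⟨σ, by ext i; simp⟩

end SplitElements

/-! ### Counting the orbits -/

section CountOrbits

variable {n : ℕ} [NeZero n] {k : Type*} [Field k] [IsAlgClosed k] {p : ℕ} [Fact p.Prime]
  [CharP k p] {a : ℕ}

/-- Translation by constants shows that a `1/q` of all injections `h : ι → F` satisfy the linear
condition `∑ ℓ_t h_t = 0`, provided that `∑ ℓ_t` is invertible in `F`. -/
theorem card_injective_sum_eq_zero {F ι : Type*} [Field F] [Fintype ι] [Fintype F] (l : ι → F)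
    (hl : ∑ t, l t ≠ 0) :
    Nat.card {h : ι → F // Function.Injective h ∧ ∑ t, l t * h t = 0} * Fintype.card F =
      (Fintype.card F).descFactorial (Fintype.card ι) := by
  classical
  have e : {h : ι → F // Function.Injective h ∧ ∑ t, l t * h t = 0} × F ≃
      {h : ι → F // Function.Injective h} :=
    { toFun := fun x => ⟨fun t => x.1.1 t + x.2, fun s t h => x.1.2.1 (add_right_cancel h)⟩
      invFun := fun h => ⟨⟨fun t => h.1 t - (∑ t, l t * h.1 t) / ∑ t, l t,
        fun s t e => h.2 (sub_left_injective e), by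
          simp only [mul_sub, Finset.sum_sub_distrib, ← Finset.sum_mul]
          field_simp
          ring⟩, (∑ t, l t * h.1 t) / ∑ t, l t⟩
      left_inv := by
        rintro ⟨⟨h, hi, hs⟩, c⟩
        have : (∑ t, l t * (h t + c)) / ∑ t, l t = c := by
          simp only [mul_add, Finset.sum_add_distrib, hs, ← Finset.sum_mul]
          field_simp
          ring
        simp [this]
      right_inv := fun h => by simp }
  have := Nat.card_congr (e.trans (Equiv.subtypeInjectiveEquivEmbedding ι F))
  rw [Nat.card_prod, Nat.card_eq_fintype_card (α := F), Nat.card_eq_fintype_card (α := ι ↪ F),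
    Fintype.card_embedding_eq] at this
  exact this

/-- The number of orbits of genus `(J, [id])`: an orbit is a choice of distinct elements of `𝔽_q`,
one for each block of `J`, with weighted sum zero, up to permutations that preserve the block
sizes. -/
theorem genusOrbits_finite_and_ncard (ha : 1 ≤ a) (hpn : ¬p ∣ n) {J : Finset (Fin n)}
    {lam : n.Partition} (hlam : blockSizes J = lam.parts) :
    (genusOrbits p a k J).Finite ∧
      ((genusOrbits p a k J).ncard : ℚ) = genusCount lam (p ^ a) := by
  classical
  have hq : 1 ≤ p ^ a := Nat.one_le_pow _ _ (Fact.out : p.Prime).pos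
  let F := fixedField k p a
  have hF : Nat.card F = p ^ a := card_fixedField p a ha
  have : Finite F := Nat.finite_of_card_ne_zero (by omega)
  have := Fintype.ofFinite F
  rw [Nat.card_eq_fintype_card] at hF
  -- the blocks of `J` are labelled by the quotient by `Linked J`
  let Q := Quotient (⟨Linked J, linked_equivalence J⟩ : Setoid (Fin n))
  let b : Fin n → Q := Quotient.mk _
  have hb : Function.Surjective b := Quotient.mk_surjective
  have hJb : ∀ i j, Linked J i j ↔ b i = b j := fun i j =>
    (Quotient.eq (r := ⟨Linked J, linked_equivalence J⟩)).symm
  let l : Q → ℕ := fun t => (Finset.univ.filter fun i => b i = t).card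
  have hl : Finset.univ.val.map l = lam.parts := (blockSizes_eq_map hb hJb).symm.trans hlam
  have hcardQ : Fintype.card Q = lam.parts.card := by
    rw [← hl, Multiset.card_map]; rfl
  have hfiber : ∀ f : Q → F, ∑ i, f (b i) = ∑ t, (l t : F) * f t := fun f => by
    rw [← Finset.sum_fiberwise Finset.univ b]
    refine Finset.sum_congr rfl fun t _ => ?_
    rw [← nsmul_eq_mul, ← Finset.sum_const]
    exact Finset.sum_congr rfl fun i hi => by rw [(Finset.mem_filter.mp hi).2]
  have hlsum : ∑ t, (l t : F) ≠ 0 := by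
    have h := hfiber 1
    simp only [Pi.one_apply, mul_one, Finset.sum_const, Finset.card_univ, Fintype.card_fin,
      nsmul_eq_mul] at h
    rw [← h]
    have : CharP F p := inferInstance
    exact fun h0 => hpn ((CharP.cast_eq_zero_iff F p n).mp h0)
  let A : Finset (Q → F) := Finset.univ.filter fun h =>
    Function.Injective h ∧ ∑ t, (l t : F) * h t = 0
  have hA : A.card * p ^ a = (p ^ a).descFactorial lam.parts.card := by
    have := card_injective_sum_eq_zero (fun t => (l t : F)) hlsum
    rw [Nat.card_eq_fintype_card, Fintype.card_subtype, hF, hcardQ] at this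
    exact this
  let Φ : (Q → F) → Set (Matrix (Fin n) (Fin n) k) := fun h =>
    orbit p a (diagonal fun i => (h (b i) : k))
  have hΦ : genusOrbits p a k J = (A.image Φ : Finset _) := by
    ext O
    rw [Finset.coe_image]
    constructor
    · rintro ⟨x, hx, rfl⟩
      obtain ⟨d, hdq, hsum, hd, g, hg, rfl⟩ := (inGenus_iff ha J x).mp hx
      let h : Q → F := Quotient.lift (fun i => (⟨d i, hdq i⟩ : F))
        fun i j hij => Subtype.ext ((hd i j).mp hij)
      have hhb : ∀ i, h (b i) = ⟨d i, hdq i⟩ := fun i => rfl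
      refine ⟨h, ?_, (orbit_adj hg _).symm⟩
      rw [Finset.mem_coe, Finset.mem_filter]
      refine ⟨Finset.mem_univ _, fun s t hst => ?_, ?_⟩
      · obtain ⟨i, rfl⟩ := hb s
        obtain ⟨j, rfl⟩ := hb t
        exact (hJb i j).mp ((hd i j).mpr (congrArg Subtype.val hst))
      · rw [← hfiber]
        apply Subtype.ext
        rw [AddSubmonoidClass.coe_finsetSum]
        exact hsum
    · rintro ⟨h, hh, rfl⟩
      obtain ⟨-, hinj, hsum⟩ := Finset.mem_filter.mp (Finset.mem_coe.mp hh)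
      refine ⟨_, (inGenus_iff ha J _).mpr ⟨fun i => (h (b i) : k), fun i => (h (b i)).2, ?_,
        fun i j => ?_, 1, one_mem _, rfl⟩, (orbit_adj (one_mem _) _).symm⟩
      · rw [← hfiber] at hsum
        have := congrArg Subtype.val hsum
        rwa [AddSubmonoidClass.coe_finsetSum] at this
      · rw [hJb, Subtype.coe_inj, hinj.eq_iff]
  -- two labellings give the same orbit exactly if a permutation preserving block sizes relates them
  have hfib : ∀ h ∈ A, (A.filter fun h' => Φ h' = Φ h).card =
      (Finset.univ.filter fun π : Equiv.Perm Q => l ∘ π = l).card := by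
    intro h hh
    obtain ⟨-, hinj, hsum⟩ := Finset.mem_filter.mp hh
    have hperm : ∀ π : Equiv.Perm Q, l ∘ π = l →
        ∃ ρ : Equiv.Perm (Fin n), ∀ i, b (ρ i) = π (b i) := by
      intro π hπ
      refine exists_equiv_of_map_eq (fun i => π (b i)) b ?_
      ext t
      rw [Multiset.count_map, Multiset.count_map]
      have h1 : l (π (π⁻¹ t)) = l (π⁻¹ t) := congrFun hπ _
      rw [← Equiv.Perm.mul_apply, mul_inv_cancel, Equiv.Perm.one_apply] at h1
      have h2 : (Finset.univ.filter fun i => t = π (b i)) =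
          Finset.univ.filter fun i => b i = π⁻¹ t :=
        Finset.filter_congr fun i _ => by rw [Equiv.Perm.eq_inv_iff_eq, eq_comm]
      have h3 : (Finset.univ.filter fun i => t = b i) = Finset.univ.filter fun i => b i = t :=
        Finset.filter_congr fun i _ => eq_comm
      change (Finset.univ.filter fun i => t = π (b i)).card =
        (Finset.univ.filter fun i => t = b i).card
      rw [h2, h3]
      exact h1.symm
    symm
    refine Finset.card_bij (fun π _ => h ∘ π) ?_ ?_ ?_
    · intro π hπ
      have hπ : l ∘ π = l := (Finset.mem_filter.mp hπ).2
      obtain ⟨ρ, hρ⟩ := hperm π hπ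
      refine Finset.mem_filter.mpr ⟨Finset.mem_filter.mpr ⟨Finset.mem_univ _,
        hinj.comp π.injective, ?_⟩, ?_⟩
      · rw [← hsum]
        refine Eq.trans (Finset.sum_congr rfl fun t _ => ?_)
          (Equiv.sum_comp π fun t => (l t : F) * h t)
        rw [Function.comp_apply, show l (π t) = l t from congrFun hπ t]
      · rw [orbit_diagonal_eq_iff]
        exact ⟨ρ, funext fun i => by simp only [Function.comp_apply, hρ]⟩
    · intro π _ ρ _ e
      exact Equiv.ext fun t => hinj (congrFun e t)
    · intro h' hh'
      obtain ⟨hA', hO⟩ := Finset.mem_filter.mp hh'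
      obtain ⟨-, hinj', -⟩ := Finset.mem_filter.mp hA'
      obtain ⟨σ, hσ⟩ := (orbit_diagonal_eq_iff _ _).mp hO
      have hσ : ∀ i, h (b (σ i)) = h' (b i) := fun i => Subtype.ext (congrFun hσ i)
      have hbσ : ∀ i j, b i = b j ↔ b (σ i) = b (σ j) := fun i j => by
        rw [← hinj'.eq_iff, ← hσ, ← hσ, hinj.eq_iff]
      let f : Q → Q := Quotient.lift (fun i => b (σ i))
        fun i j hij => (hbσ i j).mp ((hJb i j).mp hij)
      have hf : ∀ i, f (b i) = b (σ i) := fun i => rfl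
      have hfinj : Function.Injective f := by
        intro s t hst
        obtain ⟨i, rfl⟩ := hb s
        obtain ⟨j, rfl⟩ := hb t
        exact (hbσ i j).mpr hst
      let π : Equiv.Perm Q := Equiv.ofBijective f (Finite.injective_iff_bijective.mp hfinj)
      refine ⟨π, Finset.mem_filter.mpr ⟨Finset.mem_univ _, funext fun t => ?_⟩, funext fun t => ?_⟩
      · obtain ⟨j, rfl⟩ := hb t
        symm
        refine Finset.card_bij (fun i _ => σ i) (fun i hi => ?_) (fun i _ i' _ e => σ.injective e)
          fun i hi => ⟨σ⁻¹ i, ?_, by simp⟩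
        · have hi : b i = b j := (Finset.mem_filter.mp hi).2
          exact Finset.mem_filter.mpr ⟨Finset.mem_univ _, (hbσ i j).mp hi⟩
        · have hi : b i = b (σ j) := (Finset.mem_filter.mp hi).2
          refine Finset.mem_filter.mpr ⟨Finset.mem_univ _, (hbσ _ _).mpr ?_⟩
          rw [← Equiv.Perm.mul_apply, mul_inv_cancel, Equiv.Perm.one_apply, hi]
      · obtain ⟨j, rfl⟩ := hb t
        exact hσ j
  have hstab := card_perm_preserving (n := n) l fun t => by
    have ht : l t ∈ lam.parts := hl ▸ Multiset.mem_map_of_mem _ (Finset.mem_univ t)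
    exact Finset.mem_Icc.mpr ⟨lam.parts_pos ht, lam.le_of_mem_parts ht⟩
  rw [hl] at hstab
  have hcount : A.card =
      (A.image Φ).card * ∏ i ∈ Finset.Icc 1 n, (lam.parts.count i).factorial := by
    rw [Finset.card_eq_sum_card_image Φ A, ← smul_eq_mul, ← Finset.sum_const]
    refine Finset.sum_congr rfl fun O hO => ?_
    obtain ⟨h, hh, rfl⟩ := Finset.mem_image.mp hO
    rw [hfib h hh, hstab]
  refine ⟨hΦ ▸ Finset.finite_toSet _, ?_⟩
  rw [hΦ, Set.ncard_coe_finset, genusCount, prod_sub_eq_descFactorial hq, eq_div_iff]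
  · have hpos : 0 < lam.parts.card := by
      rw [← hcardQ]
      exact Fintype.card_pos_iff.mpr ⟨b 0⟩
    obtain ⟨m, hm⟩ : ∃ m, lam.parts.card = m + 1 := ⟨lam.parts.card - 1, by omega⟩
    obtain ⟨r, hr⟩ : ∃ r, p ^ a = r + 1 := ⟨p ^ a - 1, by omega⟩
    rw [hm, hr, Nat.succ_descFactorial_succ, mul_comm] at hA
    have := Nat.eq_of_mul_eq_mul_left (Nat.succ_pos r) hA
    rw [hm, hr, Nat.add_sub_cancel, Nat.add_sub_cancel, ← this, hcount]
    push_cast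
    rfl
  · exact Finset.prod_ne_zero_iff.mpr fun i _ => Nat.cast_ne_zero.mpr (Nat.factorial_ne_zero _)

end CountOrbits

end SplitGenus

end

theorem theorem3 (n p a : ℕ) [NeZero n] [Fact p.Prime] (k : Type*) [Field k] [IsAlgClosed k]
    [CharP k p] (hn : 2 ≤ n) (ha : 1 ≤ a) (hpn : ¬ p ∣ n) :
    (∀ J : Finset (Fin n), J ≠ Finset.univ →
      (SplitGenus.genusOrbits p a k J).Finite ∧
      ((SplitGenus.genusOrbits p a k J).ncard : ℚ) = SplitGenus.sommersSum J (p ^ a)) ∧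
    (∀ lam : n.Partition,
      (SplitGenus.splitOrbits p a k lam).Finite ∧
      ((SplitGenus.splitOrbits p a k lam).ncard : ℚ) = SplitGenus.genusCount lam (p ^ a)) ∧
    (∀ (lam : n.Partition) (J : Finset (Fin n)), J ≠ Finset.univ → SplitGenus.HasType J lam →
      SplitGenus.genusOrbits p a k J = SplitGenus.splitOrbits p a k lam ∧
      SplitGenus.sommersSum J (p ^ a) = SplitGenus.genusCount lam (p ^ a)) := by
  have hq : 1 ≤ p ^ a := Nat.one_le_pow _ _ (Fact.out : p.Prime).pos
  refine ⟨fun J hJ => ?_, fun lam => ?_, fun lam J hJ hlam => ?_⟩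
  · obtain ⟨lam, hlam⟩ := SplitGenus.exists_partition_eq_blockSizes hJ
    rw [SplitGenus.sommersSum_eq_genusCount hn hJ hlam hq]
    exact SplitGenus.genusOrbits_finite_and_ncard ha hpn hlam
  · obtain ⟨J, hJ, hlam⟩ := SplitGenus.exists_blockSizes_eq lam
    rw [← SplitGenus.genusOrbits_eq_splitOrbits ha hJ hlam]
    exact SplitGenus.genusOrbits_finite_and_ncard ha hpn hlam
  · rw [SplitGenus.hasType_iff] at hlam
    exact ⟨SplitGenus.genusOrbits_eq_splitOrbits ha hJ hlam,
      SplitGenus.sommersSum_eq_genusCount hn hJ hlam hq⟩
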